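/- **Setting.** Let $n\ge 1$, $s\in\mathbb R$, $\mu_s(x)=(1+|x|^2)^{s/2}$, and $\mathbb T^n=[-\tfrac12,\tfrac12)^n$ with Lebesgue measure. Let $H^s=H^s(\mathbb R^n)$ be the space of tempered distributions $f$ with $\mu_s\widehat f\in L^2(\mathbb R^n)$, with $\langle f,g\rangle_{H^s}=\int_{\mathbb R^n}\widehat f\,\overline{\widehat g}\,\mu_s^2\,dt$ and $\widehat f(t)=\int f(x)e^{-2\pi i\langle x,t\rangle}dx$. Let $\ell^2_s$ be the Hilbert space of sequences $c=(c_k)_{k\in\mathbb Z^n}$ of complex numbers with $\|c\|_{\ell^2_s}^2=\sum_{k}|c_k|^2\mu_s(k)^2<\infty$. For $f\in H^s$ and a.e. $t\in\mathbb T^n$ put $$\mathcal T_sf(t)=\Big(\frac{\mu_s(t+k)\widehat f(t+k)}{\mu_s(k)}\Big)_{k\in\mathbb Z^n}\in\ell^2_s .$$ A subspace $V\subset H^s$ is shift-invariant (SI) if $T_kf=f(\cdot-k)\in V$ for all $f\in V$, $k\in\mathbb Z^n$. For $\varphi\in H^s$ let $S_s(\varphi)=\overline{\operatorname{span}}\{T_k\varphi:k\in\mathbb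 Z^n\}$ (a principal shift-invariant, PSI, space). A range function is a map $J$ from $\mathbb T^n$ to the closed subspaces of $\ell^2_s$; it is measurable if, with $P(t)$ the orthogonal projection onto $J(t)$, all functions $t\mapsto\langle P(t)a,b\rangle_{\ell^2_s}$ ($a,b\in\ell^2_s$) are measurable. A measurable range function $J$ belongs to $V$ if $V=\{f\in H^s:\mathcal T_sf(t)\in J(t)\text{ for a.e. }t\in\mathbb T^n\}$; then $\dim_V(t)=\dim J(t)\in\mathbb N_0\cup\{\infty\}$ and $\sigma_V=\{t\in\mathbb T^n:J(t)\ne\{0\}\}$. **Theorem.** Let $V_s\subset H^s$ be a closed SI space. Then $V_s$ has a measurable range function, and there are $\varphi_i\in H^s$, $i\in\mathbb N$, such that the PSI spaces $V_s^i=S_s(\varphi_i)$ are pairwise orthogonal, $V_s$ is their orthogonal sum $V_s=\overline{\bigoplus_{i\in\mathbb N}V_s^i}$, each $V_s^i$ has a measurable range function, and, for every choice of measurable range functions belonging to these spaces: 1. $\varphi_i$ is a quasi-orthogonal generator of $V_s^i$: $\|\mathcal T_s\varphi_i(t)\|_{\ell^2_s}=\mathbf 1_{\sigma_{V_s^i}}(t)$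 for a.e. $t\in\mathbb T^n$, for every $i$; 2. $\sigma_{V_s^{i+1}}\subset\sigma_{V_s^i}$ up to a null set, for every $i$; 3. $\dim_{V_s}(t)=\sum_{i\in\mathbb N}\|\mathcal T_s\varphi_i(t)\|_{\ell^2_s}$ for a.e. $t\in\mathbb T^n$ (as elements of $[0,\infty]$). -/

import Mathlib

open MeasureTheory FourierTransform Filter Topology
open scoped SchwartzMap ENNReal InnerProductSpace ContDiff

noncomputable section

namespace ShiftInvariant

/-- The Euclidean space `ℝⁿ`. -/
abbrev Euc (n : ℕ) : Type := EuclideanSpace ℝ (Fin n)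

/-- The lattice point `k ∈ ℤⁿ`, regarded as a point of `ℝⁿ`. -/
def lat {n : ℕ} (k : Fin n → ℤ) : Euc n := WithLp.toLp 2 fun i => (k i : ℝ)

/-- The weight `μ_s(x) = (1 + |x|²)^{s/2}`. -/
def wt {n : ℕ} (s : ℝ) (x : Euc n) : ℝ := (1 + ‖x‖ ^ 2) ^ (s / 2)

theorem wt_pos {n : ℕ} (s : ℝ) (x : Euc n) : 0 < wt s x := by
  unfold wt; positivity

/-- The cube `[-1/2, 1/2)ⁿ`. -/
def cube (n : ℕ) : Set (Euc n) := {t | ∀ i, t i ∈ Set.Ico (-(1 / 2) : ℝ) (1 / 2)}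

/-- The cube `𝕋ⁿ = [-1/2, 1/2)ⁿ` as a type; it carries Lebesgue measure. -/
abbrev Cube (n : ℕ) : Type := cube n

instance (n : ℕ) : MeasureSpace (Cube n) := Measure.Subtype.measureSpace

/-! ### The weighted sequence space `ℓ²_s(ℤⁿ)` -/

/-- The sequences `c = (c_k)_{k ∈ ℤⁿ}` with `(c_k μ_s(k))_k ∈ ℓ²`. -/
def seqSubmodule (n : ℕ) (s : ℝ) : Submodule ℂ ((Fin n → ℤ) → ℂ) where
  carrier := {c | Memℓp (fun k => (wt s (lat k) : ℂ) * c k) 2}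
  zero_mem' := by
    refine (congrArg (fun f : (Fin n → ℤ) → ℂ => Memℓp f 2) ?_).mp
      (zero_memℓp : Memℓp (0 : (Fin n → ℤ) → ℂ) 2)
    funext k
    simp
  add_mem' {a b} ha hb := by
    have h := Memℓp.add ha hb
    refine (congrArg (fun f : (Fin n → ℤ) → ℂ => Memℓp f 2) ?_).mp h
    funext k
    simp [mul_add]
  smul_mem' r a ha := by
    have h := Memℓp.const_smul ha r
    refine (congrArg (fun f : (Fin n → ℤ) → ℂ => Memℓp f 2) ?_).mp h
    funext k
    simp [mul_left_comm]

/-- The space `ℓ²_s(ℤⁿ)`. -/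
def Seq (n : ℕ) (s : ℝ) : Type := seqSubmodule n s

namespace Seq

variable {n : ℕ} {s : ℝ}

instance : AddCommGroup (Seq n s) := inferInstanceAs (AddCommGroup (seqSubmodule n s))

instance : Module ℂ (Seq n s) := inferInstanceAs (Module ℂ (seqSubmodule n s))

/-- The `k`-th entry of a sequence in `ℓ²_s`. -/
def entry (c : Seq n s) (k : Fin n → ℤ) : ℂ := c.1 k

/-- The linear bijection `(c_k)_k ↦ (μ_s(k) c_k)_k` of `ℓ²_s` onto `ℓ²`. -/
def toLp : Seq n s ≃ₗ[ℂ] lp (fun _ : Fin n → ℤ => ℂ) 2 where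
  toFun c := ⟨fun k => (wt s (lat k) : ℂ) * c.1 k, c.2⟩
  map_add' a b := by
    ext k
    exact mul_add _ _ _
  map_smul' r a := by
    ext k
    exact mul_left_comm _ _ _
  invFun d := ⟨fun k => (wt s (lat k) : ℂ)⁻¹ * d k, by
    refine (congrArg (fun f : (Fin n → ℤ) → ℂ => Memℓp f 2) ?_).mp (lp.memℓp d)
    funext k
    have h : (wt s (lat k) : ℂ) ≠ 0 := by exact_mod_cast (wt_pos s (lat k)).ne'
    field_simp⟩
  left_inv c := by
    refine Subtype.ext ?_
    funext k
    have h : (wt s (lat k) : ℂ) ≠ 0 := by exact_mod_cast (wt_pos s (lat k)).ne'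
    change (wt s (lat k) : ℂ)⁻¹ * ((wt s (lat k) : ℂ) * c.1 k) = c.1 k
    field_simp
  right_inv d := by
    ext k
    have h : (wt s (lat k) : ℂ) ≠ 0 := by exact_mod_cast (wt_pos s (lat k)).ne'
    change (wt s (lat k) : ℂ) * ((wt s (lat k) : ℂ)⁻¹ * d k) = d k
    field_simp

/-- The norm of `ℓ²_s` is `‖c‖ = ‖(μ_s(k) c_k)_k‖_{ℓ²}`. -/
instance : NormedAddCommGroup (Seq n s) :=
  NormedAddCommGroup.induced (Seq n s) (lp (fun _ : Fin n → ℤ => ℂ) 2) toLp toLp.injective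

/-- The inner product of `ℓ²_s` is that of `ℓ²` applied to `(μ_s(k) c_k)_k`, `(μ_s(k) d_k)_k`. -/
instance : InnerProductSpace ℂ (Seq n s) where
  inner c d := ⟪toLp c, toLp d⟫_ℂ
  norm_smul_le a b := by
    change ‖toLp (a • b)‖ ≤ ‖a‖ * ‖toLp b‖
    rw [map_smul]
    exact norm_smul_le a (toLp b)
  norm_sq_eq_re_inner c := norm_sq_eq_re_inner (𝕜 := ℂ) (toLp c)
  conj_inner_symm c d := inner_conj_symm (𝕜 := ℂ) (toLp c) (toLp d)
  add_left a b c := by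
    change ⟪toLp (a + b), toLp c⟫_ℂ = ⟪toLp a, toLp c⟫_ℂ + ⟪toLp b, toLp c⟫_ℂ
    rw [map_add, inner_add_left]
  smul_left a b r := by
    change ⟪toLp (r • a), toLp b⟫_ℂ = starRingEnd ℂ r * ⟪toLp a, toLp b⟫_ℂ
    rw [map_smul, inner_smul_left]

/-- `c ↦ μ_s c` as an isometric isomorphism of `ℓ²_s` onto `ℓ²`. -/
def toLpIsometry : Seq n s ≃ₗᵢ[ℂ] lp (fun _ : Fin n → ℤ => ℂ) 2 where
  toLinearEquiv := toLp
  norm_map' _ := rfl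

instance : CompleteSpace (Seq n s) :=
  (completeSpace_congr (e := (toLpIsometry (n := n) (s := s)).toEquiv)
    toLpIsometry.isometry.isUniformInducing.isUniformEmbedding).mpr inferInstance

end Seq

/-! ### The Sobolev space `H^s(ℝⁿ)` -/

/-- The tempered distributions `f` on `ℝⁿ` with `μ_s f̂ ∈ L²`. -/
def sobolevSubmodule (n : ℕ) (s : ℝ) : Submodule ℂ 𝓢'(Euc n, ℂ) where
  carrier := {f | TemperedDistribution.MemSobolev s 2 f}
  zero_mem' := TemperedDistribution.memSobolev_fun_zero _ _ s 2
  add_mem' hf hg := hf.add hg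
  smul_mem' c _ hf := hf.smul c

/-- The space `H^s = H^s(ℝⁿ)`. -/
def Sob (n : ℕ) (s : ℝ) : Type := sobolevSubmodule n s

namespace Sob

variable {n : ℕ} {s : ℝ}

instance : AddCommGroup (Sob n s) := inferInstanceAs (AddCommGroup (sobolevSubmodule n s))

instance : Module ℂ (Sob n s) := inferInstanceAs (Module ℂ (sobolevSubmodule n s))

/-- The tempered distribution underlying an element of `H^s`. -/
def dist (f : Sob n s) : 𝓢'(Euc n, ℂ) := f.1

theorem exists_wfourier (f : Sob n s) : ∃ g : Lp ℂ 2 (volume : Measure (Euc n)),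
    TemperedDistribution.smulLeftCLM ℂ (fun x : Euc n => ((wt s x : ℝ) : ℂ)) (𝓕 f.dist) =
      (g : 𝓢'(Euc n, ℂ)) :=
  TemperedDistribution.memSobolev_iff_exists_smulLeftCLM_fourier.mp f.2

/-- The function `μ_s f̂ ∈ L²(ℝⁿ)`, that is `ĝ` for `g = (1 - Δ/4π²)^{s/2} f`. -/
def wfourier (f : Sob n s) : Lp ℂ 2 (volume : Measure (Euc n)) := f.exists_wfourier.choose

theorem wfourier_spec (f : Sob n s) :
    TemperedDistribution.smulLeftCLM ℂ (fun x : Euc n => ((wt s x : ℝ) : ℂ)) (𝓕 f.dist) =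
      (f.wfourier : 𝓢'(Euc n, ℂ)) :=
  f.exists_wfourier.choose_spec

theorem Lp_ext {g h : Lp ℂ 2 (volume : Measure (Euc n))}
    (H : (g : 𝓢'(Euc n, ℂ)) = (h : 𝓢'(Euc n, ℂ))) : g = h :=
  LinearMap.ker_eq_bot.mp
    (Lp.ker_toTemperedDistributionCLM_eq_bot (F := ℂ) (μ := (volume : Measure (Euc n))) (p := 2)) H

/-- `f ↦ μ_s f̂` as a linear map `H^s → L²`. -/
def wfourierₗ : Sob n s →ₗ[ℂ] Lp ℂ 2 (volume : Measure (Euc n)) where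
  toFun := wfourier
  map_add' f g := by
    apply Lp_ext
    rw [← wfourier_spec, ← Lp.toTemperedDistributionCLM_apply, map_add,
      Lp.toTemperedDistributionCLM_apply, Lp.toTemperedDistributionCLM_apply,
      ← wfourier_spec, ← wfourier_spec, ← map_add, ← FourierTransform.fourier_add]
    rfl
  map_smul' c f := by
    apply Lp_ext
    rw [← wfourier_spec, ← Lp.toTemperedDistributionCLM_apply, map_smul,
      Lp.toTemperedDistributionCLM_apply, ← wfourier_spec, RingHom.id_apply, ← map_smul,
      ← FourierTransform.fourier_smul]
    rfl

theorem wfourierₗ_injective : Function.Injective (wfourierₗ (n := n) (s := s)) := by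
  rw [injective_iff_map_eq_zero]
  intro f hf
  have h1 := wfourier_spec f
  have h0 : f.wfourier = 0 := hf
  rw [h0, ← Lp.toTemperedDistributionCLM_apply, map_zero] at h1
  have h2 := congrArg
    (TemperedDistribution.smulLeftCLM ℂ (fun x : Euc n => ((wt (-s) x : ℝ) : ℂ))) h1
  have e1 : (fun x : Euc n => ((wt s x : ℝ) : ℂ)).HasTemperateGrowth := by
    unfold wt; fun_prop
  have e2 : (fun x : Euc n => ((wt (-s) x : ℝ) : ℂ)).HasTemperateGrowth := by
    unfold wt; fun_prop
  rw [TemperedDistribution.smulLeftCLM_smulLeftCLM_apply e1 e2, map_zero] at h2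
  have e3 : ((fun x : Euc n => ((wt s x : ℝ) : ℂ)) * fun x : Euc n => ((wt (-s) x : ℝ) : ℂ)) =
      fun _ => 1 := by
    funext x
    have h : wt s x * wt (-s) x = 1 := by
      unfold wt
      rw [← Real.rpow_add (by positivity)]
      ring_nf
      simp
    simp only [Pi.mul_apply]
    exact_mod_cast h
  rw [e3, TemperedDistribution.smulLeftCLM_const, one_smul] at h2
  have h3 : f.dist = 0 := by
    have h4 := congrArg (fun u : 𝓢'(Euc n, ℂ) => 𝓕⁻ u) h2
    simp only [FourierTransform.fourierInv_fourier_eq] at h4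
    rw [h4]
    ext u
    simp
  exact Subtype.ext h3

/-- The norm of `H^s` is `‖f‖ = ‖μ_s f̂‖_{L²}`. -/
instance : NormedAddCommGroup (Sob n s) :=
  NormedAddCommGroup.induced (Sob n s) (Lp ℂ 2 (volume : Measure (Euc n))) wfourierₗ
    wfourierₗ_injective

/-- The inner product of `H^s` is the `L²` inner product of `μ_s f̂` and `μ_s ĝ`
(conjugate-linear in the first argument). -/
instance : InnerProductSpace ℂ (Sob n s) where
  inner f g := ⟪wfourierₗ f, wfourierₗ g⟫_ℂ
  norm_smul_le a b := by
    change ‖wfourierₗ (a • b)‖ ≤ ‖a‖ * ‖wfourierₗ b‖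
    rw [map_smul]
    exact norm_smul_le a (wfourierₗ b)
  norm_sq_eq_re_inner c := norm_sq_eq_re_inner (𝕜 := ℂ) (wfourierₗ c)
  conj_inner_symm c d := inner_conj_symm (𝕜 := ℂ) (wfourierₗ c) (wfourierₗ d)
  add_left a b c := by
    change ⟪wfourierₗ (a + b), wfourierₗ c⟫_ℂ = ⟪wfourierₗ a, wfourierₗ c⟫_ℂ + ⟪wfourierₗ b, wfourierₗ c⟫_ℂ
    rw [map_add, inner_add_left]
  smul_left a b r := by
    change ⟪wfourierₗ (r • a), wfourierₗ b⟫_ℂ = starRingEnd ℂ r * ⟪wfourierₗ a, wfourierₗ b⟫_ℂ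
    rw [map_smul, inner_smul_left]

end Sob

/-! ### Translations -/

/-- The translation `f ↦ f(· - a)` of tempered distributions: `⟨f(· - a), u⟩ = ⟨f, u(· + a)⟩`. -/
def translate {n : ℕ} (a : Euc n) : 𝓢'(Euc n, ℂ) →L[ℂ] 𝓢'(Euc n, ℂ) :=
  PointwiseConvergenceCLM.precomp ℂ (SchwartzMap.compSubConstCLM ℂ (-a))

/-- The character `ξ ↦ exp(-2πi⟨a, ξ⟩)`. -/
def modChar {n : ℕ} (a : Euc n) (ξ : Euc n) : ℂ :=
  Complex.exp (((-2 * Real.pi * ⟪a, ξ⟫_ℝ : ℝ) : ℂ) * Complex.I)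

theorem cexp_mul_I_temperate :
    (fun x : ℝ => Complex.exp ((x : ℂ) * Complex.I)).HasTemperateGrowth := by
  have hd : ∀ m : ℕ, iteratedDeriv m (fun x : ℝ => Complex.exp ((x : ℂ) * Complex.I)) =
      fun x : ℝ => Complex.I ^ m * Complex.exp ((x : ℂ) * Complex.I) := by
    intro m
    induction m with
    | zero => funext x; simp
    | succ m ih =>
      rw [iteratedDeriv_succ, ih]
      funext x
      have h1 : HasDerivAt (fun x : ℝ => (x : ℂ) * Complex.I) (1 * Complex.I) x :=
        (Complex.ofRealCLM.hasDerivAt (x := x)).mul_const Complex.I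
      have h2 := (h1.cexp).const_mul (Complex.I ^ m)
      rw [h2.deriv]
      ring
  refine ⟨(Complex.ofRealCLM.contDiff.mul contDiff_const).cexp, fun m => ⟨0, 1, fun x => ?_⟩⟩
  rw [norm_iteratedFDeriv_eq_norm_iteratedDeriv, hd]
  simp [Complex.norm_exp_ofReal_mul_I]

theorem modChar_temperate {n : ℕ} (a : Euc n) : (modChar a).HasTemperateGrowth := by
  have h : (fun ξ : Euc n => -2 * Real.pi * ⟪a, ξ⟫_ℝ).HasTemperateGrowth := by
    have := ((-2 * Real.pi) • innerSL ℝ a).hasTemperateGrowth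
    exact this
  exact cexp_mul_I_temperate.comp h

theorem translate_eq {n : ℕ} (a : Euc n) (f : 𝓢'(Euc n, ℂ)) :
    translate a f = TemperedDistribution.fourierMultiplierCLM ℂ (modChar a) f := by
  ext u
  change f _ = f _
  congr 1
  set w : 𝓢(Euc n, ℂ) := 𝓕⁻ u with hw
  have hu : u = 𝓕 w := by rw [hw, FourierTransform.fourier_fourierInv_eq]
  rw [hu]
  ext x
  change (𝓕 w : 𝓢(Euc n, ℂ)) (x - -a) =
    (𝓕 (SchwartzMap.smulLeftCLM ℂ (modChar a) (𝓕⁻ (𝓕 w))) : 𝓢(Euc n, ℂ)) x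
  rw [FourierTransform.fourierInv_fourier_eq]
  simp only [SchwartzMap.fourier_coe, Real.fourier_eq']
  congr 1
  funext v
  rw [SchwartzMap.smulLeftCLM_apply_apply (modChar_temperate a), smul_eq_mul, smul_eq_mul,
    smul_eq_mul, ← mul_assoc, modChar, ← Complex.exp_add]
  congr 2
  rw [sub_neg_eq_add, inner_add_right, real_inner_comm v a]
  push_cast
  ring

theorem memSobolev_translate {n : ℕ} {s : ℝ} (a : Euc n) {f : 𝓢'(Euc n, ℂ)}
    (hf : TemperedDistribution.MemSobolev s 2 f) :
    TemperedDistribution.MemSobolev s 2 (translate a f) := by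
  rw [translate_eq]
  refine hf.fourierMultiplierCLM_of_bounded (modChar_temperate a) ⟨1, fun x => ?_⟩
  exact (Complex.norm_exp_ofReal_mul_I _).le

/-- The operator `T_k f = f(· - k)` on `H^s`, for `k ∈ ℤⁿ`. -/
def shift {n : ℕ} {s : ℝ} (k : Fin n → ℤ) (f : Sob n s) : Sob n s :=
  ⟨translate (lat k) f.dist, memSobolev_translate _ f.2⟩

/-! ### Shift-invariant spaces -/

variable {n : ℕ} {s : ℝ}

/-- `V ⊆ H^s` is shift-invariant: `T_k f ∈ V` for all `f ∈ V` and `k ∈ ℤⁿ`. -/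
def IsShiftInvariant (V : Submodule ℂ (Sob n s)) : Prop :=
  ∀ f ∈ V, ∀ k : Fin n → ℤ, shift k f ∈ V

/-- The principal shift-invariant space `S_s(φ)`: the closed linear span of `{T_k φ : k ∈ ℤⁿ}`. -/
def psi (φ : Sob n s) : Submodule ℂ (Sob n s) :=
  (Submodule.span ℂ (Set.range fun k : Fin n → ℤ => shift k φ)).topologicalClosure

open Classical in
/-- The fibre `𝒯_s f(t) = (ĝ(t + k) / μ_s(k))_{k ∈ ℤⁿ} ∈ ℓ²_s` at `t ∈ 𝕋ⁿ`, where
`g = (1 - Δ/4π²)^{s/2} f`, that is `ĝ = μ_s f̂`. The sequence lies in `ℓ²_s` for almost every `t`;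
the value on the remaining null set is irrelevant, and is taken to be `0`. -/
def fiber (f : Sob n s) (t : Cube n) : Seq n s :=
  if h : (fun k : Fin n → ℤ => f.wfourier (t.1 + lat k) / (wt s (lat k) : ℂ)) ∈ seqSubmodule n s
  then ⟨_, h⟩ else (0 : Seq n s)

/-- A range function: an assignment of a closed subspace of `ℓ²_s` to every `t ∈ 𝕋ⁿ`. -/
abbrev RangeFunction (n : ℕ) (s : ℝ) : Type := Cube n → ClosedSubmodule ℂ (Seq n s)

instance (W : ClosedSubmodule ℂ (Seq n s)) : CompleteSpace W.toSubmodule :=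
  W.isClosed.completeSpace_coe

/-- A range function `J` is measurable if the orthogonal projections `P(t)` of `ℓ²_s` onto `J(t)`
are (weakly) measurable in `t`: every `t ↦ ⟨P(t) a, b⟩` is Lebesgue measurable on `𝕋ⁿ`. -/
def RangeFunction.IsMeasurable (J : RangeFunction n s) : Prop :=
  ∀ a b : Seq n s, AEMeasurable
    (fun t : Cube n => ⟪b, (J t).toSubmodule.starProjection a⟫_ℂ) volume

/-- `J` is a measurable range function associated with `V`:
`V = {f ∈ H^s : 𝒯_s f(t) ∈ J(t) for a.e. t ∈ 𝕋ⁿ}`. -/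
def IsRangeFunctionOf (J : RangeFunction n s) (V : Submodule ℂ (Sob n s)) : Prop :=
  J.IsMeasurable ∧ ∀ f : Sob n s, f ∈ V ↔ ∀ᵐ t : Cube n, fiber f t ∈ J t

/-- The dimension function `t ↦ dim J(t) ∈ ℕ₀ ∪ {∞}`. -/
def RangeFunction.dim (J : RangeFunction n s) (t : Cube n) : ℕ∞ :=
  Cardinal.toENat (Module.rank ℂ (J t).toSubmodule)

/-- The spectrum `{t ∈ 𝕋ⁿ : J(t) ≠ {0}}`. -/
def RangeFunction.spectrum (J : RangeFunction n s) : Set (Cube n) :=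
  {t | (J t).toSubmodule ≠ ⊥}

end ShiftInvariant

end

open ShiftInvariant

open ShiftInvariant

namespace ShiftInvariant

variable {n : ℕ} {s : ℝ}

/-! ### The Fourier side of `H^s` -/

/-! The fiber map identifies `H^s` isometrically with the `ℓ²_s`-valued square-integrable functions
on the cube: cut `μ_s f̂` along the tiling of `ℝⁿ` by lattice translates of the cube and stack the
pieces. Characters of `ℤⁿ` are lattice-periodic, so `T_k` becomes multiplication of the whole fiber
at `t` by the scalar `modChar (lat k) t`. Hence the inner products of `g` with the shifts of `φ` are
the Fourier coefficients of `t ↦ ⟪fiber φ t, fiber g t⟫`. By uniqueness of Fourier coefficients,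
orthogonality to all shifts is orthogonality of almost every pair of fibers
(`ae_inner_fiber_eq_zero`). Every statement about shift-invariant spaces thereby becomes one about
subspaces of `ℓ²_s` depending on `t`.

For the range function of `V`, take a dense sequence `d m` in `ℓ²_s`, regard each term as a constant
field, project it onto `V` and let the fibers of the projections span `J(t)`. The remainders have
fibers orthogonal to `J(t)`, so the projection onto `V` acts fiberwise as the projection onto `J(t)`
(`exists_isRangeFunctionOf_rangeSpan`). Two range functions of one space agree almost everywhere
(`IsRangeFunctionOf.ae_eq`), which takes care of arbitrary choices.

For the decomposition, apply Gram-Schmidt at each `t` to the spanning sequence, dependent vectors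
giving `0`, and move the zeros behind the nonzero vectors (`exists_quasi_orthonormal_frame`). The
resulting fields `v i` are measurable and bounded, hence fibers of elements `φ i`. Their nonzero
values form an orthonormal system with closed span `J(t)`. Counting them gives the dimension, and
having the zeros last makes the spectra decrease. -/

theorem wt_temperate (s : ℝ) : (fun x : Euc n => ((wt s x : ℝ) : ℂ)).HasTemperateGrowth := by
  unfold wt; fun_prop

theorem wt_mul_wt_neg (s : ℝ) :
    ((fun x : Euc n => ((wt s x : ℝ) : ℂ)) * fun x : Euc n => ((wt (-s) x : ℝ) : ℂ)) =
      fun _ => 1 := by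
  funext x
  have h : wt s x * wt (-s) x = 1 := by
    unfold wt
    rw [← Real.rpow_add (by positivity)]
    ring_nf
    simp
  simp only [Pi.mul_apply]
  exact_mod_cast h

namespace Sob

theorem wfourier_surjective (g : Lp ℂ 2 (volume : Measure (Euc n))) :
    ∃ f : Sob n s, f.wfourier = g := by
  set u : 𝓢'(Euc n, ℂ) := 𝓕⁻ (TemperedDistribution.smulLeftCLM ℂ
    (fun x : Euc n => ((wt (-s) x : ℝ) : ℂ)) (g : 𝓢'(Euc n, ℂ))) with hu
  have h : TemperedDistribution.smulLeftCLM ℂ (fun x : Euc n => ((wt s x : ℝ) : ℂ)) (𝓕 u) =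
      (g : 𝓢'(Euc n, ℂ)) := by
    rw [hu, FourierTransform.fourier_fourierInv_eq,
      TemperedDistribution.smulLeftCLM_smulLeftCLM_apply (wt_temperate _) (wt_temperate _),
      mul_comm, wt_mul_wt_neg, TemperedDistribution.smulLeftCLM_const, one_smul]
  have hm : TemperedDistribution.MemSobolev s 2 u :=
    TemperedDistribution.memSobolev_iff_exists_smulLeftCLM_fourier.mpr ⟨g, h⟩
  refine ⟨⟨u, hm⟩, Lp_ext ?_⟩
  exact (wfourier_spec ⟨u, hm⟩).symm.trans h

/-- `f ↦ μ_s f̂` as an isometric isomorphism of `H^s` onto `L²`. -/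
noncomputable def wfourierIsometry : Sob n s ≃ₗᵢ[ℂ] Lp ℂ 2 (volume : Measure (Euc n)) where
  toLinearEquiv := LinearEquiv.ofBijective wfourierₗ ⟨wfourierₗ_injective, wfourier_surjective⟩
  norm_map' _ := rfl

instance : CompleteSpace (Sob n s) :=
  (completeSpace_congr (e := (wfourierIsometry (n := n) (s := s)).toEquiv)
    wfourierIsometry.isometry.isUniformInducing.isUniformEmbedding).mpr inferInstance

end Sob

theorem modChar_norm (a x : Euc n) : ‖modChar a x‖ = 1 := Complex.norm_exp_ofReal_mul_I _

theorem modChar_memLp_top (a : Euc n) : MemLp (modChar a) ∞ (volume : Measure (Euc n)) :=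
  memLp_top_of_bound (modChar_temperate a).1.continuous.aestronglyMeasurable 1
    (ae_of_all _ fun x => (modChar_norm a x).le)

/-- Translation is the Fourier multiplier with symbol `modChar`, and multiplication by this symbol
commutes with multiplication by the weight. -/
theorem wfourier_shift (k : Fin n → ℤ) (f : Sob n s) :
    (shift k f).wfourier =ᵐ[volume] fun x => modChar (lat k) x * f.wfourier x := by
  have h : (shift k f).wfourier = ((modChar_memLp_top (lat k)).toLp _) • f.wfourier := by
    apply Sob.Lp_ext
    rw [Lp.toTemperedDistribution_smul_eq (modChar_temperate _), ← Sob.wfourier_spec,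
      ← Sob.wfourier_spec]
    change TemperedDistribution.smulLeftCLM ℂ _ (𝓕 (translate (lat k) f.dist)) = _
    rw [translate_eq, TemperedDistribution.fourierMultiplierCLM_apply,
      FourierTransform.fourier_fourierInv_eq,
      TemperedDistribution.smulLeftCLM_smulLeftCLM_apply (wt_temperate _) (modChar_temperate _),
      TemperedDistribution.smulLeftCLM_smulLeftCLM_apply (modChar_temperate _) (wt_temperate _),
      mul_comm]
  rw [h]
  filter_upwards [Lp.coeFn_lpSMul (r := 2) ((modChar_memLp_top (lat k)).toLp _) f.wfourier,
    (modChar_memLp_top (lat k)).coeFn_toLp] with x h1 h2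
  rw [h1, Pi.smul_apply', h2, smul_eq_mul]

theorem modChar_add_lat (k m : Fin n → ℤ) (x : Euc n) :
    modChar (lat k) (x + lat m) = modChar (lat k) x := by
  have h : ⟪(lat k : Euc n), lat m⟫_ℝ = ((∑ i, k i * m i : ℤ) : ℝ) := by
    simp [lat, PiLp.inner_apply, mul_comm]
  unfold modChar
  rw [inner_add_right, h, Complex.exp_eq_exp_iff_exists_int]
  refine ⟨-∑ i, k i * m i, ?_⟩
  push_cast
  ring

/-! ### The tiling of `ℝⁿ` by the translates of the cube -/

/-- The lattice point of the translate of the cube that contains `x`. -/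
noncomputable def nearestLat (x : Euc n) : Fin n → ℤ := fun i => ⌊x i + 1 / 2⌋

theorem measurable_nearestLat : Measurable (nearestLat (n := n)) := by
  unfold nearestLat; fun_prop

theorem lat_apply (k : Fin n → ℤ) (i : Fin n) : lat k i = k i := rfl

theorem nearestLat_eq_iff (x : Euc n) (k : Fin n → ℤ) : nearestLat x = k ↔ x - lat k ∈ cube n := by
  simp only [nearestLat, funext_iff, Int.floor_eq_iff, cube, Set.mem_ofPred_eq, Set.mem_Ico,
    PiLp.sub_apply, lat_apply]
  refine forall_congr' fun i => ⟨fun h => ⟨?_, ?_⟩, fun h => ⟨?_, ?_⟩⟩ <;> linarith [h.1, h.2]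

theorem nearestLat_add (t : Cube n) (k : Fin n → ℤ) : nearestLat (t.1 + lat k) = k := by
  rw [nearestLat_eq_iff, add_sub_cancel_right]; exact t.2

theorem measurableSet_cube : MeasurableSet (cube n) := by
  have : cube n = nearestLat ⁻¹' {0} := by
    ext x
    have h0 : lat (0 : Fin n → ℤ) = (0 : Euc n) := by ext i; simp [lat_apply]
    rw [Set.mem_preimage, Set.mem_singleton_iff, nearestLat_eq_iff, h0, sub_zero]
  rw [this]
  exact measurable_nearestLat (measurableSet_singleton _)

/-- The level sets of `nearestLat` partition space into translates of the cube; translation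
invariance moves each integral back to the cube. -/
theorem lintegral_eq_lintegral_cube {h : Euc n → ℝ≥0∞} (hh : Measurable h) :
    ∫⁻ x, h x = ∫⁻ t : Cube n, ∑' k : Fin n → ℤ, h (t.1 + lat k) := by
  have h1 : ∀ k : Fin n → ℤ, ∫⁻ t : Cube n, h (t.1 + lat k) =
      ∫⁻ x in nearestLat ⁻¹' {k}, h x := by
    intro k
    have e : nearestLat ⁻¹' {k} = (fun x : Euc n => x - lat k) ⁻¹' cube n := by
      ext x; exact nearestLat_eq_iff x k
    rw [← lintegral_indicator (measurable_nearestLat (measurableSet_singleton _)),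
      ← lintegral_add_right_eq_self _ (lat k : Euc n)]
    change ∫⁻ t : Cube n, h (t.1 + lat k) ∂(Measure.comap Subtype.val volume) = _
    rw [lintegral_subtype_comap measurableSet_cube (fun x => h (x + lat k)),
      ← lintegral_indicator measurableSet_cube]
    refine lintegral_congr fun x => ?_
    rw [e]
    by_cases hx : x ∈ cube n
    · rw [Set.indicator_of_mem hx, Set.indicator_of_mem (by simpa using hx)]
    · rw [Set.indicator_of_notMem hx, Set.indicator_of_notMem (by simpa using hx)]
  rw [lintegral_tsum fun k => by fun_prop]
  simp_rw [h1]
  rw [← lintegral_iUnion (fun k => measurable_nearestLat (measurableSet_singleton k))]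
  · rw [← Set.preimage_iUnion, Set.iUnion_of_singleton, Set.preimage_univ, setLIntegral_univ]
  · intro k l hkl
    exact Disjoint.preimage _ (by simpa using hkl)

instance : IsFiniteMeasure (volume : Measure (Cube n)) := by
  constructor
  change Measure.comap Subtype.val volume Set.univ < ⊤
  rw [comap_subtype_coe_apply measurableSet_cube, Set.image_univ, Subtype.range_coe]
  refine Bornology.IsBounded.measure_lt_top ?_
  have h : Bornology.IsBounded (Set.univ.pi fun _ : Fin n => Set.Ico (-(1 / 2) : ℝ) (1 / 2)) :=
    Bornology.IsBounded.pi fun _ => Metric.isBounded_Ico _ _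
  have h2 := (PiLp.antilipschitzWith_ofLp 2 (fun _ : Fin n => ℝ)).isBounded_preimage h
  refine h2.subset fun x hx => ?_
  simpa [cube] using hx

theorem ae_cube_of_ae {p : Euc n → Prop} (hp : ∀ᵐ x, p x) :
    ∀ᵐ t : Cube n, ∀ k : Fin n → ℤ, p (t.1 + lat k) := by
  obtain ⟨N, hN, hNm, hN0⟩ := exists_measurable_superset_of_null (ae_iff.mp hp)
  have h := lintegral_eq_lintegral_cube (h := N.indicator 1) (measurable_one.indicator hNm)
  rw [lintegral_indicator_one hNm, hN0] at h
  have h2 := (lintegral_eq_zero_iff (Measurable.tsum fun k =>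
    (measurable_one.indicator hNm).comp
      (by fun_prop : Measurable fun t : Cube n => t.1 + lat k))).mp h.symm
  filter_upwards [h2] with t ht k
  by_contra hk
  have := ENNReal.tsum_eq_zero.mp ht k
  rw [Function.comp_apply, Set.indicator_of_mem (hN hk)] at this
  simp at this

/-! ### Square-summable sequences and square-integrable functions -/

theorem memℓp_two_iff {ι : Type*} {f : ι → ℂ} : Memℓp f 2 ↔ ∑' k, ‖f k‖ₑ ^ 2 ≠ ⊤ := by
  rw [memℓp_gen_iff (by norm_num)]
  have h : ∀ k, ‖f k‖ₑ ^ 2 = ((‖f k‖₊ ^ 2 : NNReal) : ℝ≥0∞) := fun k => by simp [enorm]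
  simp_rw [h]
  rw [ENNReal.tsum_coe_ne_top_iff_summable, ← NNReal.summable_coe]
  simp

theorem enorm_sq_lp {ι : Type*} (f : lp (fun _ : ι => ℂ) 2) : ‖f‖ₑ ^ 2 = ∑' k, ‖f k‖ₑ ^ 2 := by
  have h := lp.hasSum_norm (by norm_num) f
  have h2 : HasSum (fun k => ‖f k‖₊ ^ 2) (‖f‖₊ ^ 2) := by
    rw [← NNReal.hasSum_coe]
    simpa using h
  have h3 := (ENNReal.hasSum_coe.mpr h2).tsum_eq
  simpa [enorm] using h3.symm

theorem eLpNorm_two_sq {X E : Type*} [MeasurableSpace X] [NormedAddCommGroup E] (μ : Measure X)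
    (f : X → E) : eLpNorm f 2 μ ^ 2 = ∫⁻ x, ‖f x‖ₑ ^ 2 ∂μ := by
  have h := eLpNorm_nnreal_pow_eq_lintegral (f := f) (μ := μ) (p := 2) (by norm_num)
  simpa using h

/-- A square-summable sequence is the limit of its finite truncations, so measurability can be
checked entry by entry. -/
theorem aestronglyMeasurable_lp {X ι : Type*} [MeasurableSpace X] [Countable ι] {μ : Measure X}
    {F : X → lp (fun _ : ι => ℂ) 2} (hF : ∀ k, AEStronglyMeasurable (fun x => F x k) μ) :
    AEStronglyMeasurable F μ := by
  classical
  refine aestronglyMeasurable_of_tendsto_ae (atTop : Filter (Finset ι))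
    (f := fun S x => ∑ k ∈ S, lp.single 2 k (F x k)) (fun S => ?_)
    (ae_of_all _ fun x => lp.hasSum_single (by norm_num) (F x))
  refine Finset.aestronglyMeasurable_fun_sum _ fun k _ => ?_
  exact (lp.isometry_single (E := fun _ : ι => ℂ) (p := 2) k).continuous.comp_aestronglyMeasurable
    (hF k)

theorem separableSpace_lp (ι : Type*) [Countable ι] :
    TopologicalSpace.SeparableSpace (lp (fun _ : ι => ℂ) 2) := by
  classical
  have h1 : TopologicalSpace.IsSeparable
      (Submodule.span ℂ (Set.range fun k : ι => lp.single (E := fun _ : ι => ℂ) 2 k (1 : ℂ)) :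
        Set (lp (fun _ : ι => ℂ) 2)) :=
    (Set.countable_range _).isSeparable.span
  rw [← TopologicalSpace.isSeparable_univ_iff]
  refine h1.closure.mono fun f _ => ?_
  refine mem_closure_of_tendsto (lp.hasSum_single (by norm_num) f) (Eventually.of_forall fun S => ?_)
  refine Submodule.sum_mem _ fun k _ => ?_
  have : lp.single (E := fun _ : ι => ℂ) 2 k (f k) = f k • lp.single 2 k (1 : ℂ) := by
    rw [← lp.single_smul]; simp
  rw [this]
  exact Submodule.smul_mem _ _ (Submodule.subset_span ⟨k, rfl⟩)

instance : TopologicalSpace.SeparableSpace (Seq n s) := by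
  have := separableSpace_lp (Fin n → ℤ)
  exact (Seq.toLpIsometry (n := n) (s := s)).symm.surjective.denseRange.separableSpace
    Seq.toLpIsometry.symm.continuous

theorem Seq.enorm_sq (c : Seq n s) : ‖c‖ₑ ^ 2 = ∑' k, ‖Seq.toLp c k‖ₑ ^ 2 := by
  rw [← enorm_sq_lp]; rfl

theorem Seq.aestronglyMeasurable {X : Type*} [MeasurableSpace X] {μ : Measure X} {F : X → Seq n s}
    (hF : ∀ k, AEStronglyMeasurable (fun x => Seq.toLp (F x) k) μ) : AEStronglyMeasurable F μ := by
  have h := (Seq.toLpIsometry (n := n) (s := s)).symm.continuous.comp_aestronglyMeasurable (aestronglyMeasurable_lp hF)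
  refine h.congr (ae_of_all _ fun x => ?_)
  exact Seq.toLpIsometry.symm_apply_apply (F x)

theorem Seq.toLp_apply (c : Seq n s) (k : Fin n → ℤ) :
    Seq.toLp c k = (wt s (lat k) : ℂ) * c.1 k := rfl

theorem Seq.ext {c d : Seq n s} (h : ∀ k, Seq.toLp c k = Seq.toLp d k) : c = d :=
  Seq.toLp.injective (lp.ext (funext h))

/-! ### The fibers of an element of `H^s` -/

theorem mem_seqSubmodule_iff (g : Euc n → ℂ) (t : Euc n) :
    (fun k : Fin n → ℤ => g (t + lat k) / (wt s (lat k) : ℂ)) ∈ seqSubmodule n s ↔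
      ∑' k : Fin n → ℤ, ‖g (t + lat k)‖ₑ ^ 2 ≠ ⊤ := by
  rw [← memℓp_two_iff]
  change Memℓp (fun k => (wt s (lat k) : ℂ) * (g (t + lat k) / (wt s (lat k) : ℂ))) 2 ↔ _
  congr! 2 with k
  have h : (wt s (lat k) : ℂ) ≠ 0 := by exact_mod_cast (wt_pos s (lat k)).ne'
  field_simp

theorem lintegral_tsum_wfourier (f : Sob n s) :
    ∫⁻ t : Cube n, ∑' k : Fin n → ℤ, ‖f.wfourier (t.1 + lat k)‖ₑ ^ 2 =
      eLpNorm f.wfourier 2 volume ^ 2 := by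
  rw [eLpNorm_two_sq, lintegral_eq_lintegral_cube]
  exact (Lp.stronglyMeasurable _).measurable.enorm.pow_const 2

/-- The sum of squares over a fiber has finite integral, so it is finite almost everywhere. Thus the
default value `0` in `fiber` occurs only on a null set, and the weights cancel. -/
theorem toLp_fiber (f : Sob n s) :
    ∀ᵐ t : Cube n, ∀ k, Seq.toLp (fiber f t) k = f.wfourier (t.1 + lat k) := by
  have h : ∀ᵐ t : Cube n, ∑' k : Fin n → ℤ, ‖f.wfourier (t.1 + lat k)‖ₑ ^ 2 < ⊤ := by
    refine ae_lt_top' (Measurable.aemeasurable ?_) ?_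
    · refine Measurable.tsum fun k => ?_
      exact ((Lp.stronglyMeasurable _).measurable.comp (by fun_prop)).enorm.pow_const 2
    · rw [lintegral_tsum_wfourier]
      exact ENNReal.pow_ne_top (Lp.eLpNorm_ne_top _)
  filter_upwards [h] with t ht k
  have hmem : (fun k : Fin n → ℤ => f.wfourier (t.1 + lat k) / (wt s (lat k) : ℂ)) ∈
      seqSubmodule n s := (mem_seqSubmodule_iff _ _).mpr ht.ne
  have hf : fiber f t = ⟨_, hmem⟩ := dif_pos hmem
  rw [Seq.toLp_apply, hf]
  have h : (wt s (lat k) : ℂ) ≠ 0 := by exact_mod_cast (wt_pos s (lat k)).ne'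
  change (wt s (lat k) : ℂ) * (f.wfourier (t.1 + lat k) / (wt s (lat k) : ℂ)) = _
  field_simp

theorem aestronglyMeasurable_fiber (f : Sob n s) :
    AEStronglyMeasurable (fiber f) (volume : Measure (Cube n)) := by
  refine Seq.aestronglyMeasurable fun k => ?_
  have h : StronglyMeasurable fun t : Cube n => f.wfourier (t.1 + lat k) :=
    ((Lp.stronglyMeasurable _).measurable.comp (by fun_prop)).stronglyMeasurable
  refine h.aestronglyMeasurable.congr ?_
  filter_upwards [toLp_fiber f] with t ht using (ht k).symm

theorem eLpNorm_fiber (f : Sob n s) :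
    eLpNorm (fiber f) 2 volume = eLpNorm f.wfourier 2 volume := by
  have h : eLpNorm (fiber f) 2 volume ^ 2 = eLpNorm f.wfourier 2 volume ^ 2 := by
    rw [← lintegral_tsum_wfourier, eLpNorm_two_sq]
    refine lintegral_congr_ae ?_
    filter_upwards [toLp_fiber f] with t ht
    simp_rw [Seq.enorm_sq, ht]
  exact (ENNReal.pow_right_strictMono two_ne_zero).injective h

theorem memLp_fiber (f : Sob n s) : MemLp (fiber f) 2 (volume : Measure (Cube n)) :=
  ⟨aestronglyMeasurable_fiber f, by
    rw [eLpNorm_fiber]; exact (Lp.memLp f.wfourier).eLpNorm_lt_top⟩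

theorem fiber_add (f g : Sob n s) : ∀ᵐ t : Cube n, fiber (f + g) t = fiber f t + fiber g t := by
  have h : (f + g).wfourier = f.wfourier + g.wfourier := map_add Sob.wfourierₗ f g
  filter_upwards [toLp_fiber (f + g), toLp_fiber f, toLp_fiber g,
    ae_cube_of_ae (Lp.coeFn_add f.wfourier g.wfourier)] with t h1 h2 h3 h4
  refine Seq.ext fun k => ?_
  rw [h1, map_add, lp.coeFn_add, Pi.add_apply, h2, h3, h, h4, Pi.add_apply]

theorem fiber_smul (c : ℂ) (f : Sob n s) : ∀ᵐ t : Cube n, fiber (c • f) t = c • fiber f t := by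
  have h : (c • f).wfourier = c • f.wfourier := map_smul Sob.wfourierₗ c f
  filter_upwards [toLp_fiber (c • f), toLp_fiber f,
    ae_cube_of_ae (Lp.coeFn_smul c f.wfourier)] with t h1 h2 h4
  refine Seq.ext fun k => ?_
  rw [h1, map_smul, lp.coeFn_smul, Pi.smul_apply, h2, h, h4, Pi.smul_apply]

/-- The fibers `f ↦ (fiber f t)_t` as a linear isometry of `H^s` into `L²(𝕋ⁿ; ℓ²_s)`. -/
noncomputable def fiberIsometry : Sob n s →ₗᵢ[ℂ] Lp (Seq n s) 2 (volume : Measure (Cube n)) where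
  toFun f := (memLp_fiber f).toLp _
  map_add' f g := by
    rw [← MemLp.toLp_add]
    exact (MemLp.toLp_eq_toLp_iff _ _).mpr (fiber_add f g)
  map_smul' c f := by
    rw [RingHom.id_apply, ← MemLp.toLp_const_smul]
    exact (MemLp.toLp_eq_toLp_iff _ _).mpr (fiber_smul c f)
  norm_map' f := by
    change ‖(memLp_fiber f).toLp _‖ = ‖f.wfourier‖
    rw [Lp.norm_toLp, eLpNorm_fiber, Lp.norm_def]

theorem fiberIsometry_coeFn (f : Sob n s) : fiberIsometry f =ᵐ[volume] fiber f :=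
  (memLp_fiber f).coeFn_toLp

theorem fiber_sub (f g : Sob n s) : ∀ᵐ t : Cube n, fiber (f - g) t = fiber f t - fiber g t := by
  have h := map_sub fiberIsometry f g
  filter_upwards [fiberIsometry_coeFn (f - g), fiberIsometry_coeFn f, fiberIsometry_coeFn g,
    Lp.coeFn_sub (fiberIsometry f) (fiberIsometry g)] with t h1 h2 h3 h4
  rw [← h1, ← h2, ← h3, h, h4, Pi.sub_apply]

theorem inner_eq_integral_fiber (f g : Sob n s) :
    ⟪f, g⟫_ℂ = ∫ t : Cube n, ⟪fiber f t, fiber g t⟫_ℂ := by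
  rw [← fiberIsometry.inner_map_map, L2.inner_def]
  refine integral_congr_ae ?_
  filter_upwards [fiberIsometry_coeFn f, fiberIsometry_coeFn g] with t h1 h2
  rw [h1, h2]

theorem integrable_inner_fiber (f g : Sob n s) :
    Integrable (fun t : Cube n => ⟪fiber f t, fiber g t⟫_ℂ) := by
  refine (L2.integrable_inner (𝕜 := ℂ) (fiberIsometry f) (fiberIsometry g)).congr ?_
  filter_upwards [fiberIsometry_coeFn f, fiberIsometry_coeFn g] with t h1 h2
  rw [h1, h2]

theorem eq_zero_of_fiber_ae {f : Sob n s} (h : ∀ᵐ t : Cube n, fiber f t = 0) : f = 0 := by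
  rw [← inner_self_eq_zero (𝕜 := ℂ), inner_eq_integral_fiber]
  refine integral_eq_zero_of_ae ?_
  filter_upwards [h] with t ht
  simp [ht]

/-! ### Every square-integrable field on the cube is a field of fibers -/

theorem nearestLat_spec (x : Euc n) : x - lat (nearestLat x) ∈ cube n :=
  (nearestLat_eq_iff x _).mp rfl

/-- The point of the cube congruent to `x` modulo `ℤⁿ`. -/
noncomputable def toCube (x : Euc n) : Cube n := ⟨x - lat (nearestLat x), nearestLat_spec x⟩

theorem measurable_toCube : Measurable (toCube (n := n)) := by
  refine Measurable.subtype_mk (measurable_id.sub ?_)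
  exact (Measurable.of_discrete : Measurable (lat : (Fin n → ℤ) → Euc n)).comp
    measurable_nearestLat

theorem toCube_add (t : Cube n) (k : Fin n → ℤ) : toCube (t.1 + lat k) = t :=
  Subtype.ext (by simp [toCube, nearestLat_add])

theorem Seq.measurable_toLp {X : Type*} [MeasurableSpace X] {F : X → Seq n s}
    (hF : StronglyMeasurable F) (k : Fin n → ℤ) : Measurable fun x => Seq.toLp (F x) k := by
  have h : Continuous fun c : Seq n s => Seq.toLpIsometry c k :=
    (lp.evalCLM ℂ (fun _ : Fin n → ℤ => ℂ) 2 k).continuous.comp Seq.toLpIsometry.continuous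
  exact (h.comp_stronglyMeasurable hF).measurable

/-- Each point of `ℝⁿ` is `t + lat k` for exactly one `t` in the cube and one `k`, so the entries of
`F` can be laid out over the tiles as a single function; the tiling formula shows that the norm is
preserved. -/
theorem exists_memLp_periodization {F : Cube n → Seq n s} (hF : StronglyMeasurable F)
    (hF2 : eLpNorm F 2 volume < ⊤) :
    ∃ g : Euc n → ℂ, MemLp g 2 volume ∧
      ∀ (t : Cube n) (k : Fin n → ℤ), g (t.1 + lat k) = Seq.toLp (F t) k := by
  set G : Cube n × (Fin n → ℤ) → ℂ := fun q => Seq.toLp (F q.1) q.2 with hG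
  have hGm : Measurable G := measurable_from_prod_countable_left (Seq.measurable_toLp hF)
  set g : Euc n → ℂ := fun x => G (toCube x, nearestLat x) with hg
  have hgm : Measurable g := hGm.comp (measurable_toCube.prodMk measurable_nearestLat)
  have hgt : ∀ (t : Cube n) (k : Fin n → ℤ), g (t.1 + lat k) = Seq.toLp (F t) k := by
    intro t k
    rw [hg, hG]
    simp only [toCube_add, nearestLat_add]
  refine ⟨g, ⟨hgm.aestronglyMeasurable, ?_⟩, hgt⟩
  have h : eLpNorm g 2 volume ^ 2 = eLpNorm F 2 volume ^ 2 := by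
    rw [eLpNorm_two_sq, eLpNorm_two_sq, lintegral_eq_lintegral_cube (hgm.enorm.pow_const 2)]
    simp_rw [hgt, Seq.enorm_sq]
  rw [(ENNReal.pow_right_strictMono two_ne_zero).injective h]
  exact hF2

theorem exists_fiber_eq {F : Cube n → Seq n s} (hF : MemLp F 2 volume) :
    ∃ f : Sob n s, ∀ᵐ t : Cube n, fiber f t = F t := by
  obtain ⟨F', hF', hFF'⟩ := hF.1
  obtain ⟨g, hg2, hgt⟩ := exists_memLp_periodization hF' (by
    rw [← eLpNorm_congr_ae hFF']; exact hF.2)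
  obtain ⟨f, hf⟩ := Sob.wfourier_surjective (s := s) (hg2.toLp g)
  refine ⟨f, ?_⟩
  filter_upwards [toLp_fiber f, ae_cube_of_ae hg2.coeFn_toLp, hFF'] with t h1 h2 h3
  refine Seq.ext fun k => ?_
  rw [h1, hf, h2, hgt, h3]

theorem fiber_shift (k : Fin n → ℤ) (f : Sob n s) :
    ∀ᵐ t : Cube n, fiber (shift k f) t = modChar (lat k) t.1 • fiber f t := by
  filter_upwards [toLp_fiber (shift k f), toLp_fiber f, ae_cube_of_ae (wfourier_shift k f)]
    with t h1 h2 h3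
  refine Seq.ext fun m => ?_
  rw [h1, h3, map_smul, lp.coeFn_smul, Pi.smul_apply, h2, modChar_add_lat, smul_eq_mul]

/-! ### Uniqueness of Fourier coefficients on the cube -/

/-- Indicators of closed sets are bounded pointwise limits of continuous functions. By dominated
convergence the integral of `u` over the preimage of every closed set vanishes, which determines
`u`. -/
theorem ae_eq_zero_of_forall_integral_comp_mul_eq_zero {X Y : Type*} [MeasurableSpace X]
    [TopologicalSpace Y] [MeasurableSpace Y] [BorelSpace Y] [HasOuterApproxClosed Y]
    {μ : Measure X} {p : X → Y} (hp : MeasurableEmbedding p) {u : X → ℂ} (hu : Integrable u μ)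
    (h : ∀ g : C(Y, ℂ), ∫ x, g (p x) * u x ∂μ = 0) : u =ᵐ[μ] 0 := by
  -- Transported to `Y` and extended by zero off the image, `u` can be tested against closed sets of
  -- `Y`.
  set u' : Y → ℂ := Function.extend p u 0
  have hcomp : u' ∘ p = u := Function.extend_comp hp.injective u 0
  have hint : Integrable u' (μ.map p) := by
    rw [hp.integrable_map_iff, hcomp]; exact hu
  have hz : u' =ᵐ[μ.map p] 0 := by
    refine ae_eq_zero_of_forall_setIntegral_isClosed_eq_zero hint fun F hF => ?_
    rw [hp.setIntegral_map]
    change ∫ x in p ⁻¹' F, (u' ∘ p) x ∂μ = 0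
    rw [hcomp, ← integral_indicator (hp.measurable hF.measurableSet)]
    have hlim : Tendsto (fun m : ℕ => ∫ x, (((hF.apprSeq m (p x) : NNReal) : ℝ) : ℂ) * u x ∂μ) atTop
        (𝓝 (∫ x, (p ⁻¹' F).indicator u x ∂μ)) := by
      refine tendsto_integral_of_dominated_convergence (fun x => ‖u x‖) (fun m => ?_) hu.norm
        (fun m => ae_of_all _ fun x => ?_) (ae_of_all _ fun x => ?_)
      · refine AEStronglyMeasurable.mul ?_ hu.1
        have hc : Continuous fun y => (((hF.apprSeq m y : NNReal) : ℝ) : ℂ) := by fun_prop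
        exact (hc.measurable.comp hp.measurable).aestronglyMeasurable
      · rw [norm_mul]
        refine mul_le_of_le_one_left (norm_nonneg _) ?_
        have := HasOuterApproxClosed.apprSeq_apply_le_one hF m (p x)
        simpa using this
      · have ht := tendsto_pi_nhds.mp (HasOuterApproxClosed.tendsto_apprSeq hF) (p x)
        have hc : Continuous fun r : NNReal => ((r : ℝ) : ℂ) * u x := by fun_prop
        have h2 := (hc.tendsto _).comp ht
        have e : (p ⁻¹' F).indicator u x =
            (((F.indicator (fun _ => (1 : NNReal)) (p x) : NNReal) : ℝ) : ℂ) * u x := by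
          by_cases hx : p x ∈ F
          · rw [Set.indicator_of_mem (Set.mem_preimage.mpr hx), Set.indicator_of_mem hx]
            simp
          · rw [Set.indicator_of_notMem (by simpa using hx), Set.indicator_of_notMem hx]
            simp
        rw [e]
        exact h2
    refine tendsto_nhds_unique hlim ?_
    have h0 : ∀ m : ℕ, ∫ x, (((hF.apprSeq m (p x) : NNReal) : ℝ) : ℂ) * u x ∂μ = 0 := fun m =>
      h ⟨fun y => (((hF.apprSeq m y : NNReal) : ℝ) : ℂ), by fun_prop⟩
    simp_rw [h0]
    exact tendsto_const_nhds
  have hz2 := ae_of_ae_map hp.measurable.aemeasurable hz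
  filter_upwards [hz2] with x hx
  rw [← hcomp]
  exact hx

/-- The canonical bijection of the cube onto the torus `(ℝ/ℤ)ⁿ`. -/
def toTorus (t : Cube n) : UnitAddTorus (Fin n) := fun i => ((t.1 i : ℝ) : UnitAddCircle)

theorem measurable_toTorus : Measurable (toTorus (n := n)) := by
  have h : Continuous (toTorus (n := n)) := by
    unfold toTorus
    refine continuous_pi fun i => ?_
    exact (AddCircle.continuous_mk' 1).comp (by fun_prop)
  exact h.measurable

theorem toTorus_injective : Function.Injective (toTorus (n := n)) := by
  intro t t' h
  refine Subtype.ext (PiLp.ext fun i => ?_)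
  have hi := congrFun h i
  have h1 := t.2 i
  have h2 := t'.2 i
  refine (AddCircle.coe_eq_coe_iff_of_mem_Ico (p := 1) (a := -(1 / 2)) ?_ ?_).mp hi
  · exact ⟨h1.1, h1.2.trans_eq (by norm_num)⟩
  · exact ⟨h2.1, h2.2.trans_eq (by norm_num)⟩

/-- The inverse need not be continuous across the faces of the cube, but an injective measurable map
out of a standard Borel space is a measurable embedding here. -/
theorem measurableEmbedding_toTorus : MeasurableEmbedding (toTorus (n := n)) := by
  have := (measurableSet_cube (n := n)).standardBorel
  exact measurable_toTorus.measurableEmbedding toTorus_injective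

theorem mFourier_toTorus (k : Fin n → ℤ) (t : Cube n) :
    UnitAddTorus.mFourier k (toTorus t) = modChar (lat (-k)) t.1 := by
  have h : ⟪(lat (-k) : Euc n), t.1⟫_ℝ = -∑ i, (k i : ℝ) * t.1 i := by
    simp [lat, PiLp.inner_apply, mul_comm]
  change ∏ i, fourier (k i) ((t.1 i : ℝ) : UnitAddCircle) = _
  simp_rw [fourier_coe_apply, ← Complex.exp_sum]
  rw [modChar, h]
  congr 1
  push_cast
  rw [mul_neg, neg_mul, neg_mul, neg_mul, neg_mul, neg_neg, Finset.mul_sum, Finset.sum_mul]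
  refine Finset.sum_congr rfl fun i _ => ?_
  ring

/-- Integration against `u` is a continuous functional on the continuous functions of the torus. It
vanishes on the monomials, whose span is dense, hence it is zero. -/
theorem ae_eq_zero_of_forall_integral_modChar_mul {u : Cube n → ℂ} (hu : Integrable u)
    (h : ∀ k : Fin n → ℤ, ∫ t : Cube n, modChar (lat k) t.1 * u t = 0) :
    ∀ᵐ t : Cube n, u t = 0 := by
  have hbound : ∀ (g : C(UnitAddTorus (Fin n), ℂ)) (t : Cube n), ‖g (toTorus t)‖ ≤ ‖g‖ :=
    fun g t => g.norm_coe_le_norm _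
  have hint : ∀ g : C(UnitAddTorus (Fin n), ℂ),
      Integrable fun t : Cube n => g (toTorus t) * u t := fun g =>
    hu.bdd_mul (g.continuous.measurable.comp measurable_toTorus).aestronglyMeasurable
      (ae_of_all _ (hbound g))
  let L₀ : C(UnitAddTorus (Fin n), ℂ) →ₗ[ℂ] ℂ :=
    { toFun := fun g => ∫ t : Cube n, g (toTorus t) * u t
      map_add' := fun g g' => by
        rw [← integral_add (hint g) (hint g')]
        simp [add_mul]
      map_smul' := fun c g => by
        rw [RingHom.id_apply, smul_eq_mul, ← integral_const_mul]
        simp [mul_assoc] }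
  let L : C(UnitAddTorus (Fin n), ℂ) →L[ℂ] ℂ := L₀.mkContinuous (∫ t, ‖u t‖) fun g => by
    refine (norm_integral_le_integral_norm _).trans ?_
    rw [mul_comm, ← integral_const_mul]
    refine integral_mono (hint g).norm (hu.norm.const_mul _) fun t => ?_
    rw [norm_mul]
    exact mul_le_mul_of_nonneg_right (hbound g t) (norm_nonneg _)
  have hker : (Submodule.span ℂ (Set.range (UnitAddTorus.mFourier (d := Fin n)))).topologicalClosure
      ≤ L.ker := by
    refine Submodule.topologicalClosure_minimal _ (Submodule.span_le.mpr ?_) L.isClosed_ker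
    rintro _ ⟨k, rfl⟩
    change ∫ t : Cube n, UnitAddTorus.mFourier k (toTorus t) * u t = 0
    simp_rw [mFourier_toTorus]
    exact h (-k)
  rw [UnitAddTorus.span_mFourier_closure_eq_top] at hker
  exact ae_eq_zero_of_forall_integral_comp_mul_eq_zero measurableEmbedding_toTorus hu
    fun g => hker (Submodule.mem_top (x := g))

theorem conj_modChar (k : Fin n → ℤ) (x : Euc n) :
    starRingEnd ℂ (modChar (lat k) x) = modChar (lat (-k)) x := by
  have h : (lat (-k) : Euc n) = -lat k := by ext i; simp [lat_apply]
  unfold modChar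
  rw [← Complex.exp_conj, h, inner_neg_left, map_mul, Complex.conj_ofReal, Complex.conj_I]
  congr 1
  push_cast
  ring

theorem inner_shift (φ g : Sob n s) (k : Fin n → ℤ) :
    ⟪shift k φ, g⟫_ℂ = ∫ t : Cube n, modChar (lat (-k)) t.1 * ⟪fiber φ t, fiber g t⟫_ℂ := by
  rw [inner_eq_integral_fiber]
  refine integral_congr_ae ?_
  filter_upwards [fiber_shift k φ] with t ht
  rw [ht, inner_smul_left, conj_modChar]

/-- By `inner_shift` the hypothesis says that all Fourier coefficients of an integrable function on
the cube vanish. This is the passage from global to pointwise orthogonality. -/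
theorem ae_inner_fiber_eq_zero {φ g : Sob n s} (h : ∀ k, ⟪shift k φ, g⟫_ℂ = 0) :
    ∀ᵐ t : Cube n, ⟪fiber φ t, fiber g t⟫_ℂ = 0 := by
  refine ae_eq_zero_of_forall_integral_modChar_mul (integrable_inner_fiber φ g) fun k => ?_
  rw [← h (-k), inner_shift, neg_neg]

theorem inner_eq_zero_of_ae {f g : Sob n s} (h : ∀ᵐ t : Cube n, ⟪fiber f t, fiber g t⟫_ℂ = 0) :
    ⟪f, g⟫_ℂ = 0 := by
  rw [inner_eq_integral_fiber]
  exact integral_eq_zero_of_ae h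

/-! ### Principal shift-invariant spaces -/

theorem shift_mem_psi (φ : Sob n s) (k : Fin n → ℤ) : shift k φ ∈ psi φ :=
  Submodule.le_topologicalClosure _ (Submodule.subset_span ⟨k, rfl⟩)

theorem isClosed_psi (φ : Sob n s) : IsClosed (psi φ : Set (Sob n s)) :=
  Submodule.isClosed_topologicalClosure _

theorem psi_le {φ : Sob n s} {W : Submodule ℂ (Sob n s)} (hW : IsClosed (W : Set (Sob n s)))
    (h : ∀ k, shift k φ ∈ W) : psi φ ≤ W :=
  Submodule.topologicalClosure_minimal _ (Submodule.span_le.mpr (by rintro _ ⟨k, rfl⟩; exact h k)) hW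

theorem mem_orthogonal_psi_iff {φ g : Sob n s} :
    g ∈ (psi φ)ᗮ ↔ ∀ᵐ t : Cube n, ⟪fiber φ t, fiber g t⟫_ℂ = 0 := by
  refine ⟨fun h => ae_inner_fiber_eq_zero fun k => h _ (shift_mem_psi φ k), fun h => ?_⟩
  have h2 : psi φ ≤ (Submodule.span ℂ {g})ᗮ := by
    refine psi_le (Submodule.isClosed_orthogonal _) fun k => ?_
    rw [Submodule.mem_orthogonal_singleton_iff_inner_left]
    rw [inner_shift]
    refine integral_eq_zero_of_ae ?_
    filter_upwards [h] with t ht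
    simp [ht]
  intro x hx
  exact Submodule.mem_orthogonal_singleton_iff_inner_left.mp (h2 hx)

theorem psi_isOrtho {φ ψ : Sob n s} (h : ∀ᵐ t : Cube n, ⟪fiber φ t, fiber ψ t⟫_ℂ = 0) :
    psi φ ⟂ psi ψ := by
  refine (Submodule.isOrtho_iff_le.mpr ?_).symm
  refine psi_le (Submodule.isClosed_orthogonal _) fun k => ?_
  rw [mem_orthogonal_psi_iff]
  filter_upwards [h, fiber_shift k ψ] with t h1 h2
  rw [h2, inner_smul_right, h1, mul_zero]

/-! ### Range functions -/

theorem mem_orthogonal_closure_span {ι E : Type*} [NormedAddCommGroup E] [InnerProductSpace ℂ E]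
    {v : ι → E} {x : E} (h : ∀ i, ⟪v i, x⟫_ℂ = 0) :
    x ∈ (Submodule.span ℂ (Set.range v)).topologicalClosureᗮ := by
  rw [Submodule.orthogonal_closure]
  have h2 : Submodule.span ℂ (Set.range v) ≤ (Submodule.span ℂ {x})ᗮ := by
    rw [Submodule.span_le]
    rintro _ ⟨i, rfl⟩
    exact Submodule.mem_orthogonal_singleton_iff_inner_left.mpr (h i)
  exact fun y hy => Submodule.mem_orthogonal_singleton_iff_inner_left.mp (h2 hy)

theorem eq_zero_of_mem_of_mem_orthogonal {E : Type*} [NormedAddCommGroup E]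
    [InnerProductSpace ℂ E] {W : Submodule ℂ E} {x : E} (h : x ∈ W) (h' : x ∈ Wᗮ) : x = 0 :=
  inner_self_eq_zero.mp (h' x h)

theorem Seq.inner_def (c d : Seq n s) : ⟪c, d⟫_ℂ = ⟪Seq.toLp c, Seq.toLp d⟫_ℂ := rfl

theorem lp_inner_single_one {ι : Type*} [DecidableEq ι] (k : ι) (f : lp (fun _ : ι => ℂ) 2) :
    ⟪lp.single (E := fun _ : ι => ℂ) 2 k (1 : ℂ), f⟫_ℂ = f k := by
  rw [lp.inner_single_left, RCLike.inner_apply, map_one, mul_one]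

theorem Seq.exists_inner_eq_toLp (k : Fin n → ℤ) :
    ∃ b : Seq n s, ∀ c : Seq n s, ⟪b, c⟫_ℂ = Seq.toLp c k := by
  classical
  obtain ⟨b, hb⟩ := (Seq.toLp (n := n) (s := s)).surjective (lp.single 2 k (1 : ℂ))
  exact ⟨b, fun c => by rw [Seq.inner_def, hb, lp_inner_single_one]⟩

theorem Seq.aestronglyMeasurable_of_inner {X : Type*} [MeasurableSpace X] {μ : Measure X}
    {F : X → Seq n s} (hF : ∀ b : Seq n s, AEMeasurable (fun x => ⟪b, F x⟫_ℂ) μ) :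
    AEStronglyMeasurable F μ := by
  refine Seq.aestronglyMeasurable fun k => ?_
  obtain ⟨b, hb⟩ := Seq.exists_inner_eq_toLp (n := n) (s := s) k
  simp_rw [← hb]
  exact (hF b).aestronglyMeasurable

theorem RangeFunction.IsMeasurable.aestronglyMeasurable {J : RangeFunction n s}
    (hJ : J.IsMeasurable) (a : Seq n s) :
    AEStronglyMeasurable (fun t => (J t).toSubmodule.starProjection a) volume :=
  Seq.aestronglyMeasurable_of_inner fun b => hJ a b

theorem aestronglyMeasurable_inner_smul {X E : Type*} [MeasurableSpace X] [NormedAddCommGroup E]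
    [InnerProductSpace ℂ E] {μ : Measure X} {u v : X → E} (hv : AEStronglyMeasurable v μ)
    (hu : AEStronglyMeasurable u μ) : AEStronglyMeasurable (fun t => ⟪v t, u t⟫_ℂ • v t) μ :=
  (hv.inner hu).smul hv

theorem aemeasurable_const_inner {X E : Type*} [MeasurableSpace X] [NormedAddCommGroup E]
    [InnerProductSpace ℂ E] {μ : Measure X} {v : X → E} (b : E) (hv : AEStronglyMeasurable v μ) :
    AEMeasurable (fun t => ⟪b, v t⟫_ℂ) μ :=
  (aestronglyMeasurable_const.inner hv).aemeasurable

theorem RangeFunction.isMeasurable_of_denseRange {ι : Type*} {J : RangeFunction n s}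
    {d : ι → Seq n s} (hd : DenseRange d)
    (h : ∀ m, AEStronglyMeasurable (fun t => (J t).toSubmodule.starProjection (d m)) volume) :
    J.IsMeasurable := by
  intro a b
  obtain ⟨u, hu, hua⟩ := mem_closure_iff_seq_limit.mp (hd a)
  refine aemeasurable_of_tendsto_metrizable_ae atTop
    (f := fun j t => ⟪b, (J t).toSubmodule.starProjection (u j)⟫_ℂ) (fun j => ?_)
    (ae_of_all _ fun t => ?_)
  · obtain ⟨m, hm⟩ := hu j
    rw [← hm]
    exact aemeasurable_const_inner b (h m)
  · have hc : Continuous fun x => ⟪b, (J t).toSubmodule.starProjection x⟫_ℂ := by fun_prop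
    exact (hc.tendsto a).comp hua

/-! ### Uniqueness and existence of range functions -/

theorem exists_fiber_eq_of_bound {F : Cube n → Seq n s} (hF : AEStronglyMeasurable F volume)
    (C : ℝ) (hC : ∀ t, ‖F t‖ ≤ C) : ∃ f : Sob n s, ∀ᵐ t : Cube n, fiber f t = F t :=
  exists_fiber_eq (MemLp.of_bound hF C (ae_of_all _ hC))

/-- Projecting a fixed vector onto `J t` gives a bounded measurable field, hence the fibers of some
element of `V`, which must lie in `K t` almost everywhere. Countably many vectors, dense in `ℓ²_s`,
give all of `J t` off a single null set. -/
theorem IsRangeFunctionOf.ae_le {J K : RangeFunction n s} {V : Submodule ℂ (Sob n s)}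
    (hJ : IsRangeFunctionOf J V) (hK : IsRangeFunctionOf K V) :
    ∀ᵐ t : Cube n, (J t).toSubmodule ≤ (K t).toSubmodule := by
  have h : ∀ m, ∀ᵐ t : Cube n, (J t).toSubmodule.starProjection
      (TopologicalSpace.denseSeq (Seq n s) m) ∈ K t := by
    intro m
    obtain ⟨f, hf⟩ := exists_fiber_eq_of_bound (hJ.1.aestronglyMeasurable
      (TopologicalSpace.denseSeq (Seq n s) m)) _ fun t => Submodule.norm_starProjection_apply_le _ _
    have hfV : f ∈ V := by
      rw [hJ.2]
      filter_upwards [hf] with t ht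
      rw [ht]
      exact Submodule.starProjection_apply_mem _ _
    filter_upwards [hf, (hK.2 f).mp hfV] with t h1 h2
    rwa [← h1]
  filter_upwards [ae_all_iff.mpr h] with t ht x hx
  have hclosed : IsClosed {a | (J t).toSubmodule.starProjection a ∈ (K t).toSubmodule} :=
    (K t).isClosed.preimage ((J t).toSubmodule.starProjection).continuous
  have h2 := (TopologicalSpace.denseRange_denseSeq (Seq n s)).induction_on
    (p := fun a => (J t).toSubmodule.starProjection a ∈ (K t).toSubmodule) x hclosed ht
  rwa [Submodule.starProjection_eq_self_iff.mpr hx] at h2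

theorem IsRangeFunctionOf.ae_eq {J K : RangeFunction n s} {V : Submodule ℂ (Sob n s)}
    (hJ : IsRangeFunctionOf J V) (hK : IsRangeFunctionOf K V) :
    ∀ᵐ t : Cube n, (J t).toSubmodule = (K t).toSubmodule := by
  filter_upwards [hJ.ae_le hK, hK.ae_le hJ] with t h1 h2 using le_antisymm h1 h2

theorem IsShiftInvariant.ae_inner_eq_zero {V : Submodule ℂ (Sob n s)} (hV : IsShiftInvariant V)
    {f g : Sob n s} (hf : f ∈ V) (hg : g ∈ Vᗮ) : ∀ᵐ t : Cube n, ⟪fiber f t, fiber g t⟫_ℂ = 0 :=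
  ae_inner_fiber_eq_zero fun k => hg _ (hV f hf k)

/-- The range function spanned by a sequence of `ℓ²_s`-valued functions. -/
noncomputable def rangeSpan (F : ℕ → Cube n → Seq n s) : RangeFunction n s := fun t =>
  ⟨(Submodule.span ℂ (Set.range fun m => F m t)).topologicalClosure,
    Submodule.isClosed_topologicalClosure _⟩

theorem rangeSpan_toSubmodule (F : ℕ → Cube n → Seq n s) (t : Cube n) :
    (rangeSpan F t).toSubmodule =
      (Submodule.span ℂ (Set.range fun m => F m t)).topologicalClosure := rfl

theorem mem_rangeSpan (F : ℕ → Cube n → Seq n s) (m : ℕ) (t : Cube n) :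
    F m t ∈ (rangeSpan F t).toSubmodule :=
  Submodule.le_topologicalClosure _ (Submodule.subset_span ⟨m, rfl⟩)

/-- `F m` represents the fibers of the projection onto `V` of the constant field `d m`.
Shift-invariance makes fibers of `V` and of its orthogonal complement pointwise orthogonal, so `F m
t` is the projection of `d m` onto the span. -/
theorem exists_isRangeFunctionOf_rangeSpan {V : Submodule ℂ (Sob n s)}
    (hc : IsClosed (V : Set (Sob n s))) (hV : IsShiftInvariant V) :
    ∃ F : ℕ → Cube n → Seq n s, (∀ m, StronglyMeasurable (F m)) ∧
      IsRangeFunctionOf (rangeSpan F) V := by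
  have : CompleteSpace V := hc.completeSpace_coe
  set d := TopologicalSpace.denseSeq (Seq n s)
  have hdr : DenseRange d := TopologicalSpace.denseRange_denseSeq _
  have hex : ∀ m, ∃ c : Sob n s, ∀ᵐ t : Cube n, fiber c t = d m := fun m =>
    exists_fiber_eq_of_bound aestronglyMeasurable_const ‖d m‖ fun _ => le_rfl
  choose c hcd using hex
  set f : ℕ → Sob n s := fun m => V.starProjection (c m)
  have hfV : ∀ m, f m ∈ V := fun m => Submodule.starProjection_apply_mem _ _
  have hgV : ∀ m, c m - f m ∈ Vᗮ := fun m => Submodule.sub_starProjection_mem_orthogonal _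
  -- Everywhere strongly measurable versions of the fibers, so that later pointwise constructions on
  -- `F` remain measurable.
  choose F hF hfF using fun m => aestronglyMeasurable_fiber (f m)
  have hsub : ∀ᵐ t : Cube n, ∀ m, fiber (c m - f m) t = d m - F m t := by
    rw [ae_all_iff]
    intro m
    filter_upwards [fiber_sub (c m) (f m), hcd m, hfF m] with t h1 h2 h3
    rw [h1, h2, h3]
  have hproj : ∀ᵐ t : Cube n, ∀ m, (rangeSpan F t).toSubmodule.starProjection (d m) = F m t := by
    have h : ∀ᵐ t : Cube n, ∀ m m', ⟪fiber (f m) t, fiber (c m' - f m') t⟫_ℂ = 0 := by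
      rw [ae_all_iff]
      intro m
      rw [ae_all_iff]
      exact fun m' => hV.ae_inner_eq_zero (hfV m) (hgV m')
    filter_upwards [h, hsub, ae_all_iff.mpr hfF] with t h1 h2 h3 m
    refine Submodule.eq_starProjection_of_mem_orthogonal (mem_rangeSpan F m t) ?_
    refine mem_orthogonal_closure_span fun i => ?_
    rw [← h2, ← h3, h1]
  have hmem : ∀ g ∈ V, ∀ᵐ t : Cube n, fiber g t ∈ (rangeSpan F t).toSubmodule := by
    intro g hg
    have h : ∀ᵐ t : Cube n, ∀ m, ⟪fiber g t, fiber (c m - f m) t⟫_ℂ = 0 := by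
      rw [ae_all_iff]
      exact fun m => hV.ae_inner_eq_zero hg (hgV m)
    filter_upwards [h, hsub, hproj] with t h1 h2 h3
    set P := (rangeSpan F t).toSubmodule.starProjection
    -- By density the fiber of `g` is orthogonal to every remainder `a - P a`. Choosing `a` to be
    -- the fiber itself forces its own remainder to vanish.
    have h4 : ∀ a, ⟪fiber g t, a - P a⟫_ℂ = 0 := fun a => by
      refine hdr.induction_on (p := fun a => ⟪fiber g t, a - P a⟫_ℂ = 0) a
        (isClosed_eq (by fun_prop) continuous_const) fun m => ?_
      rw [h3, ← h2, h1]
    have h5 : ⟪P (fiber g t), fiber g t - P (fiber g t)⟫_ℂ = 0 :=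
      Submodule.sub_starProjection_mem_orthogonal (K := (rangeSpan F t).toSubmodule) (fiber g t) _
        (Submodule.starProjection_apply_mem _ _)
    have h6 : ⟪fiber g t - P (fiber g t), fiber g t - P (fiber g t)⟫_ℂ = 0 := by
      rw [inner_sub_left, h4, h5, sub_zero]
    rw [sub_eq_zero.mp (inner_self_eq_zero.mp h6)]
    exact Submodule.starProjection_apply_mem _ _
  refine ⟨F, hF, RangeFunction.isMeasurable_of_denseRange hdr fun m => ?_, fun g => ⟨hmem g,
    fun hg => ?_⟩⟩
  · refine (hF m).aestronglyMeasurable.congr ?_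
    filter_upwards [hproj] with t ht using (ht m).symm
  -- Conversely, the fiber of `g - V.starProjection g` lies in the span of the `F m t` and is
  -- orthogonal to each of them.
  · have h : ∀ᵐ t : Cube n, ∀ m, ⟪fiber (f m) t, fiber (g - V.starProjection g) t⟫_ℂ = 0 := by
      rw [ae_all_iff]
      exact fun m => hV.ae_inner_eq_zero (hfV m) (Submodule.sub_starProjection_mem_orthogonal _)
    have h0 : g - V.starProjection g = 0 := by
      refine eq_zero_of_fiber_ae ?_
      filter_upwards [h, hg, hmem _ (Submodule.starProjection_apply_mem V g),
        fiber_sub g (V.starProjection g), ae_all_iff.mpr hfF] with t h1 h2 h3 h4 h5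
      refine eq_zero_of_mem_of_mem_orthogonal (W := (rangeSpan F t).toSubmodule) ?_ ?_
      · rw [h4]
        exact Submodule.sub_mem _ h2 h3
      · refine mem_orthogonal_closure_span fun i => ?_
        rw [← h5, h1]
    rw [sub_eq_zero.mp h0]
    exact Submodule.starProjection_apply_mem _ _

/-- A function with values of norm `0` or `1` spans a measurable range function, which belongs to
the principal shift-invariant space generated by it. -/
theorem isRangeFunctionOf_psi {φ : Sob n s} {v : Cube n → Seq n s}
    (hv : AEStronglyMeasurable v volume) (hv1 : ∀ t, v t ≠ 0 → ‖v t‖ = 1)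
    (hφ : ∀ᵐ t : Cube n, fiber φ t = v t) :
    IsRangeFunctionOf (fun t => ⟨Submodule.span ℂ {v t}, Submodule.closed_of_finiteDimensional _⟩)
      (psi φ) := by
  set K : RangeFunction n s :=
    fun t => ⟨Submodule.span ℂ {v t}, Submodule.closed_of_finiteDimensional _⟩ with hK
  -- Norms `0` and `1` make the formula valid without dividing by `‖v t‖ ^ 2`, also where `v t = 0`.
  have hP : ∀ t a, (K t).toSubmodule.starProjection a = ⟪v t, a⟫_ℂ • v t := by
    intro t a
    refine Submodule.eq_starProjection_of_mem_orthogonal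
      (Submodule.smul_mem _ _ (Submodule.mem_span_singleton_self _)) ?_
    refine Submodule.mem_orthogonal_singleton_iff_inner_right.mpr ?_
    rw [inner_sub_right, inner_smul_right, inner_self_eq_norm_sq_to_K]
    by_cases h : v t = 0
    · simp [h]
    · simp [hv1 t h]
  have hmeas : K.IsMeasurable := fun a b => by
    simp_rw [hP]
    exact aemeasurable_const_inner b (aestronglyMeasurable_inner_smul hv aestronglyMeasurable_const)
  have : CompleteSpace (psi φ) := (isClosed_psi φ).completeSpace_coe
  have hback : ∀ f : Sob n s, (∀ᵐ t : Cube n, fiber f t ∈ K t) → f ∈ psi φ := by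
    intro f hf
    rw [← (psi φ).orthogonal_orthogonal]
    intro g hg
    rw [← inner_conj_symm, inner_eq_zero_of_ae, map_zero]
    filter_upwards [hf, hφ, mem_orthogonal_psi_iff.mp hg] with t h1 h2 h3
    obtain ⟨z, hz⟩ := Submodule.mem_span_singleton.mp h1
    rw [← hz, inner_smul_left, ← h2, h3, mul_zero]
  refine ⟨hmeas, fun f => ⟨fun hf => ?_, hback f⟩⟩
  -- The fiberwise projection of `f` is the fiber field of some `z` in `psi φ`; then `f - z` lies
  -- both in `psi φ` and in its orthogonal complement.
  have hPm : MemLp (fun t => (K t).toSubmodule.starProjection (fiber f t)) 2 volume := by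
    refine (memLp_fiber f).of_le ?_ (ae_of_all _ fun t => Submodule.norm_starProjection_apply_le _ _)
    simp_rw [hP]
    exact aestronglyMeasurable_inner_smul hv (aestronglyMeasurable_fiber f)
  obtain ⟨z, hz⟩ := exists_fiber_eq hPm
  have hzψ : z ∈ psi φ := hback z (by
    filter_upwards [hz] with t ht
    rw [ht]
    exact Submodule.starProjection_apply_mem _ _)
  have hfz : f - z = 0 := by
    refine eq_zero_of_mem_of_mem_orthogonal (Submodule.sub_mem _ hf hzψ) ?_
    rw [mem_orthogonal_psi_iff]
    filter_upwards [fiber_sub f z, hz, hφ] with t h1 h2 h3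
    rw [h1, h2, h3]
    exact Submodule.sub_starProjection_mem_orthogonal (K := (K t).toSubmodule) _ _
      (Submodule.mem_span_singleton_self _)
  rw [sub_eq_zero.mp hfz]
  filter_upwards [hz] with t ht
  rw [ht]
  exact Submodule.starProjection_apply_mem _ _

/-! ### The nonzero terms of a sequence -/

section Select

variable {E : Type*} [NormedAddCommGroup E]

open Classical in
/-- `m` is the index of the `i`-th nonzero term of `w`. -/
def IsNthNonzero (w : ℕ → E) (i m : ℕ) : Prop := w m ≠ 0 ∧ Nat.count (fun j => w j ≠ 0) m = i

open Classical in
theorem IsNthNonzero.unique {w : ℕ → E} {i m m' : ℕ} (h : IsNthNonzero w i m)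
    (h' : IsNthNonzero w i m') : m = m' :=
  Nat.count_injective h.1 h'.1 (h.2.trans h'.2.symm)

open Classical in
/-- The `i`-th nonzero term of the sequence `w`, or `0` if there is none. -/
noncomputable def nthNonzero (w : ℕ → E) (i : ℕ) : E :=
  if h : ∃ m, IsNthNonzero w i m then w h.choose else 0

theorem IsNthNonzero.nthNonzero_eq {w : ℕ → E} {i m : ℕ} (h : IsNthNonzero w i m) :
    nthNonzero w i = w m := by
  have h' : ∃ m, IsNthNonzero w i m := ⟨m, h⟩
  rw [nthNonzero, dif_pos h', h'.choose_spec.unique h]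

theorem nthNonzero_eq_zero {w : ℕ → E} {i : ℕ} (h : ¬ ∃ m, IsNthNonzero w i m) :
    nthNonzero w i = 0 := dif_neg h

theorem exists_isNthNonzero {w : ℕ → E} {i : ℕ} (h : nthNonzero w i ≠ 0) :
    ∃ m, IsNthNonzero w i m := by
  by_contra h'
  exact h (nthNonzero_eq_zero h')

theorem exists_nthNonzero_eq {w : ℕ → E} {m : ℕ} (h : w m ≠ 0) : ∃ i, nthNonzero w i = w m :=
  ⟨_, IsNthNonzero.nthNonzero_eq ⟨h, rfl⟩⟩

/-- The counting function starts at `0` and grows by at most one per step, so it jumps from each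
smaller value `i` to `i + 1` at some element satisfying `p`. -/
theorem exists_count_eq {p : ℕ → Prop} [DecidablePred p] {i m : ℕ} (h : i < Nat.count p m) :
    ∃ j, p j ∧ Nat.count p j = i := by
  induction m with
  | zero => simp at h
  | succ m ih =>
    rw [Nat.count_succ] at h
    by_cases hi : i < Nat.count p m
    · exact ih hi
    · by_cases hp : p m
      · rw [if_pos hp] at h
        exact ⟨m, hp, by omega⟩
      · rw [if_neg hp] at h
        omega

theorem nthNonzero_ne_zero_of_succ {w : ℕ → E} {i : ℕ} (h : nthNonzero w (i + 1) ≠ 0) :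
    nthNonzero w i ≠ 0 := by
  classical
  obtain ⟨m, hm⟩ := exists_isNthNonzero h
  obtain ⟨j, hj⟩ := exists_count_eq (p := fun j => w j ≠ 0) (i := i) (m := m)
    (by rw [hm.2]; omega)
  rw [IsNthNonzero.nthNonzero_eq (w := w) (m := j) ⟨hj.1, by convert hj.2⟩]
  exact hj.1

open Classical in
-- Write both sides as a double sum over the pairs with `IsNthNonzero w i m`: every nonzero term has
-- exactly one rank `i`, and every rank at most one term.
theorem tsum_enorm_nthNonzero (w : ℕ → E) : ∑' i, ‖nthNonzero w i‖ₑ = ∑' m, ‖w m‖ₑ := by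
  have h1 : ∀ i, ‖nthNonzero w i‖ₑ = ∑' m, if IsNthNonzero w i m then ‖w m‖ₑ else 0 := by
    intro i
    by_cases h : ∃ m, IsNthNonzero w i m
    · obtain ⟨m, hm⟩ := h
      rw [tsum_eq_single m fun m' hm' => if_neg fun h' => hm' (h'.unique hm), if_pos hm,
        hm.nthNonzero_eq]
    · rw [nthNonzero_eq_zero h, enorm_zero]
      refine (ENNReal.tsum_eq_zero.mpr fun m => if_neg fun hm => h ⟨m, hm⟩).symm
  simp_rw [h1]
  rw [ENNReal.tsum_comm]
  refine tsum_congr fun m => ?_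
  by_cases hm : w m = 0
  · simp [hm]
  · rw [tsum_eq_single (Nat.count (fun j => w j ≠ 0) m) fun i hi => if_neg fun h => hi h.2.symm]
    exact if_pos ⟨hm, rfl⟩

open Classical in
-- The selected term is a sum of the `w m`, each cut off to the measurable set where `m` has rank
-- `i`; at every point at most one summand survives.
theorem stronglyMeasurable_nthNonzero {X : Type*} [MeasurableSpace X] {w : ℕ → X → E}
    (hw : ∀ m, StronglyMeasurable (w m)) (i : ℕ) :
    StronglyMeasurable fun t => nthNonzero (fun m => w m t) i := by
  have hset : ∀ m, MeasurableSet {t | w m t ≠ 0} := fun m => (hw m).measurableSet_support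
  have hcount : ∀ m, Measurable fun t => Nat.count (fun j => w j t ≠ 0) m := by
    intro m
    induction m with
    | zero => simp
    | succ m ih =>
      simp_rw [Nat.count_succ]
      exact ih.add (Measurable.ite (hset m) measurable_const measurable_const)
  have hS : ∀ m, MeasurableSet {t | IsNthNonzero (fun m => w m t) i m} := fun m =>
    (hset m).inter (hcount m (measurableSet_singleton i))
  refine stronglyMeasurable_of_tendsto (atTop : Filter (Finset ℕ))
    (f := fun S t => ∑ m ∈ S, {t | IsNthNonzero (fun m => w m t) i m}.indicator (w m) t)
    (fun S => Finset.stronglyMeasurable_fun_sum _ fun m _ => (hw m).indicator (hS m)) ?_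
  refine tendsto_pi_nhds.mpr fun t => ?_
  change HasSum (fun m => {t | IsNthNonzero (fun m => w m t) i m}.indicator (w m) t) _
  by_cases h : ∃ m, IsNthNonzero (fun m => w m t) i m
  · obtain ⟨m, hm⟩ := h
    rw [hm.nthNonzero_eq]
    have h2 : {t | IsNthNonzero (fun m => w m t) i m}.indicator (w m) t = w m t :=
      Set.indicator_of_mem (by exact hm) _
    rw [← h2]
    refine hasSum_single m fun m' hm' => Set.indicator_of_notMem (fun h' => hm' ?_) _
    exact IsNthNonzero.unique (w := fun m => w m t) h' hm
  · rw [nthNonzero_eq_zero h]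
    have h0 : ∀ m, {t | IsNthNonzero (fun m => w m t) i m}.indicator (w m) t = 0 := fun m =>
      Set.indicator_of_notMem (s := {t | IsNthNonzero (fun m => w m t) i m}) (fun h' => h ⟨m, h'⟩) _
    simp_rw [h0]
    exact hasSum_zero

theorem tsum_enorm_eq_encard {w : ℕ → E} (hw : ∀ m, w m ≠ 0 → ‖w m‖ = 1) :
    ∑' m, ‖w m‖ₑ = (({m | w m ≠ 0}.encard : ℕ∞) : ℝ≥0∞) := by
  rw [← ENNReal.tsum_set_one, tsum_subtype {m | w m ≠ 0} fun _ => (1 : ℝ≥0∞)]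
  refine tsum_congr fun m => ?_
  by_cases h : w m = 0
  · rw [Set.indicator_of_notMem (by simpa using h), h, enorm_zero]
  · rw [Set.indicator_of_mem (by exact h), ← ofReal_norm, hw m h, ENNReal.ofReal_one]

end Select

/-! ### Measurable orthonormalization -/

section Orthonormalization

variable {E : Type*} [NormedAddCommGroup E] [InnerProductSpace ℂ E]

theorem stronglyMeasurable_gramSchmidt {X : Type*} [MeasurableSpace X] {F : ℕ → X → E}
    (hF : ∀ m, StronglyMeasurable (F m)) (m : ℕ) :
    StronglyMeasurable fun t => InnerProductSpace.gramSchmidt ℂ (fun i => F i t) m := by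
  induction m using Nat.strong_induction_on with
  | _ m ih =>
    -- The coefficients become explicit quotients. A vanishing earlier vector causes no trouble,
    -- since division by zero gives `0` and is measurable.
    simp_rw [InnerProductSpace.gramSchmidt_def ℂ _ m, Submodule.starProjection_singleton]
    refine (hF m).sub (Finset.stronglyMeasurable_fun_sum _ fun i hi => ?_)
    have hi' := ih i (Finset.mem_Iio.mp hi)
    refine StronglyMeasurable.smul ?_ hi'
    refine Measurable.stronglyMeasurable (Measurable.div ?_ ?_)
    · exact (hi'.inner (hF m)).measurable
    · exact Complex.measurable_ofReal.comp (hi'.norm.measurable.pow_const 2)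

theorem stronglyMeasurable_gramSchmidtNormed {X : Type*} [MeasurableSpace X] {F : ℕ → X → E}
    (hF : ∀ m, StronglyMeasurable (F m)) (m : ℕ) :
    StronglyMeasurable fun t => InnerProductSpace.gramSchmidtNormed ℂ (fun i => F i t) m := by
  have h := stronglyMeasurable_gramSchmidt hF m
  unfold InnerProductSpace.gramSchmidtNormed
  refine StronglyMeasurable.smul ?_ h
  exact (Complex.measurable_ofReal.comp h.norm.measurable).inv.stronglyMeasurable

/-- With finitely many nonzero vectors the span is already closed. With infinitely many, the
algebraic rank of the closure may exceed that of the span, but `Cardinal.toENat` sends every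
infinite cardinal to `⊤`, so a lower bound suffices. -/
theorem toENat_rank_closure_span {w : ℕ → E} (hw : Orthonormal ℂ fun m : {m | w m ≠ 0} => w m) :
    Cardinal.toENat (Module.rank ℂ (Submodule.span ℂ (Set.range w)).topologicalClosure) =
      {m | w m ≠ 0}.encard := by
  have hspan : Submodule.span ℂ (Set.range fun m : {m | w m ≠ 0} => w m) =
      Submodule.span ℂ (Set.range w) := by
    refine le_antisymm (Submodule.span_mono ?_) (Submodule.span_le.mpr ?_)
    · rintro _ ⟨m, rfl⟩
      exact ⟨m, rfl⟩
    · rintro _ ⟨m, rfl⟩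
      by_cases h : w m = 0
      · rw [h]; exact Submodule.zero_mem _
      · exact Submodule.subset_span ⟨⟨m, h⟩, rfl⟩
  have hrank : Module.rank ℂ (Submodule.span ℂ (Set.range w)) =
      Cardinal.mk (Set.range fun m : {m | w m ≠ 0} => w m) := by
    rw [← hspan, rank_span hw.linearIndependent]
  have hinj := hw.linearIndependent.injective
  by_cases hfin : {m | w m ≠ 0}.Finite
  · have : Finite {m | w m ≠ 0} := hfin
    have : FiniteDimensional ℂ (Submodule.span ℂ (Set.range w)) := by
      rw [← hspan]; exact FiniteDimensional.span_of_finite ℂ (Set.finite_range _)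
    rw [(Submodule.closed_of_finiteDimensional
      (Submodule.span ℂ (Set.range w))).submodule_topologicalClosure_eq, hrank]
    exact ENat.card_congr (Equiv.ofInjective _ hinj).symm
  · rw [(Set.not_finite.mp hfin).encard_eq, Cardinal.toENat_eq_top]
    refine le_trans ?_ (Submodule.rank_mono (Submodule.le_topologicalClosure _))
    rw [hrank]
    have : Infinite {m | w m ≠ 0} := Set.infinite_coe_iff.mpr (Set.not_finite.mp hfin)
    have := (Set.infinite_range_of_injective hinj).to_subtype
    exact Cardinal.aleph0_le_mk _

theorem inner_nthNonzero {w : ℕ → E} (hw : ∀ m m', m ≠ m' → ⟪w m, w m'⟫_ℂ = 0) {i j : ℕ}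
    (hij : i ≠ j) : ⟪nthNonzero w i, nthNonzero w j⟫_ℂ = 0 := by
  by_cases hi : ∃ m, IsNthNonzero w i m
  · by_cases hj : ∃ m, IsNthNonzero w j m
    · obtain ⟨m, hm⟩ := hi
      obtain ⟨m', hm'⟩ := hj
      rw [hm.nthNonzero_eq, hm'.nthNonzero_eq]
      refine hw m m' ?_
      rintro rfl
      exact hij (hm.2.symm.trans hm'.2)
    · rw [nthNonzero_eq_zero hj, inner_zero_right]
  · rw [nthNonzero_eq_zero hi, inner_zero_left]

theorem inner_gramSchmidtNormed (f : ℕ → E) {m m' : ℕ} (h : m ≠ m') :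
    ⟪InnerProductSpace.gramSchmidtNormed ℂ f m, InnerProductSpace.gramSchmidtNormed ℂ f m'⟫_ℂ = 0 := by
  unfold InnerProductSpace.gramSchmidtNormed
  rw [inner_smul_left, inner_smul_right, InnerProductSpace.gramSchmidt_orthogonal ℂ f h,
    mul_zero, mul_zero]

end Orthonormalization

/-! ### The decomposition theorem -/

/-- A closed shift-invariant space has a range function spanned by a measurable orthogonal
sequence with values of norm `0` or `1` whose nonzero values come first. -/
theorem exists_quasi_orthonormal_frame {V : Submodule ℂ (Sob n s)}
    (hc : IsClosed (V : Set (Sob n s))) (hV : IsShiftInvariant V) :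
    ∃ (J : RangeFunction n s) (v : ℕ → Cube n → Seq n s), IsRangeFunctionOf J V ∧
      (∀ i, StronglyMeasurable (v i)) ∧ (∀ i t, v i t ≠ 0 → ‖v i t‖ = 1) ∧
      (∀ i j t, i ≠ j → ⟪v i t, v j t⟫_ℂ = 0) ∧ (∀ i t, v (i + 1) t ≠ 0 → v i t ≠ 0) ∧
      (∀ i t, v i t ∈ (J t).toSubmodule) ∧
      (∀ t x, (∀ i, ⟪v i t, x⟫_ℂ = 0) → x ∈ (J t).toSubmoduleᗮ) ∧
      ∀ t, ((J.dim t : ℕ∞) : ℝ≥0∞) = ∑' i, ‖v i t‖ₑ := by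
  obtain ⟨F, hF, hJ⟩ := exists_isRangeFunctionOf_rangeSpan hc hV
  set w : ℕ → Cube n → Seq n s :=
    fun m t => InnerProductSpace.gramSchmidtNormed ℂ (fun i => F i t) m with hw
  have hJw : ∀ t, (rangeSpan F t).toSubmodule =
      (Submodule.span ℂ (Set.range fun m => w m t)).topologicalClosure := fun t => by
    rw [rangeSpan_toSubmodule]
    exact congrArg Submodule.topologicalClosure
      ((InnerProductSpace.span_gramSchmidtNormed_range fun i => F i t).trans
        (InnerProductSpace.span_gramSchmidt ℂ fun i => F i t)).symm
  have hw1 : ∀ t m, w m t ≠ 0 → ‖w m t‖ = 1 := fun t m h =>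
    InnerProductSpace.gramSchmidtNormed_unit_length' h
  refine ⟨rangeSpan F, fun i t => nthNonzero (fun m => w m t) i, hJ, fun i =>
    stronglyMeasurable_nthNonzero (stronglyMeasurable_gramSchmidtNormed hF) i, fun i t h => ?_,
    fun i j t h => inner_nthNonzero (fun m m' hm => inner_gramSchmidtNormed _ hm) h,
    fun i t h => nthNonzero_ne_zero_of_succ h, fun i t => ?_, fun t x hx => ?_, fun t => ?_⟩
  · obtain ⟨m, hm⟩ := exists_isNthNonzero h
    dsimp only
    rw [hm.nthNonzero_eq]
    exact hw1 t m hm.1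
  · by_cases h : ∃ m, IsNthNonzero (fun m => w m t) i m
    · obtain ⟨m, hm⟩ := h
      dsimp only
      rw [hm.nthNonzero_eq, hJw]
      exact Submodule.le_topologicalClosure _ (Submodule.subset_span ⟨m, rfl⟩)
    · dsimp only
      rw [nthNonzero_eq_zero h]
      exact Submodule.zero_mem _
  · rw [hJw]
    refine mem_orthogonal_closure_span fun m => ?_
    -- Reordering drops only zeros: every nonzero `w m t` reappears as some `nthNonzero` term.
    by_cases h : w m t = 0
    · rw [h, inner_zero_left]
    · obtain ⟨i, hi⟩ := exists_nthNonzero_eq (w := fun m => w m t) h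
      rw [← hi]
      exact hx i
  · rw [tsum_enorm_nthNonzero, tsum_enorm_eq_encard (hw1 t), ← toENat_rank_closure_span]
    · rw [← hJw]
      rfl
    · exact InnerProductSpace.gramSchmidtNormed_orthonormal' fun i => F i t

end ShiftInvariant

theorem mainTheorem5 (n : ℕ) (hn : 1 ≤ n) (s : ℝ) (V : Submodule ℂ (Sob n s))
    (hVclosed : IsClosed (V : Set (Sob n s))) (hVshift : IsShiftInvariant V) :
    (∃ J : RangeFunction n s, IsRangeFunctionOf J V) ∧
    ∃ φ : ℕ → Sob n s,
      (∀ i j : ℕ, i ≠ j → psi (φ i) ⟂ psi (φ j)) ∧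
      V = (⨆ i : ℕ, psi (φ i)).topologicalClosure ∧
      (∀ i : ℕ, ∃ K : RangeFunction n s, IsRangeFunctionOf K (psi (φ i))) ∧
      (∀ (i : ℕ) (K : RangeFunction n s), IsRangeFunctionOf K (psi (φ i)) →
        ∀ᵐ t : Cube n, ‖fiber (φ i) t‖ = Set.indicator K.spectrum (fun _ => (1 : ℝ)) t) ∧
      (∀ (i : ℕ) (K K' : RangeFunction n s), IsRangeFunctionOf K (psi (φ i)) →
        IsRangeFunctionOf K' (psi (φ (i + 1))) →
        ∀ᵐ t : Cube n, t ∈ K'.spectrum → t ∈ K.spectrum) ∧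
      (∀ J : RangeFunction n s, IsRangeFunctionOf J V →
        ∀ᵐ t : Cube n, ((J.dim t : ℕ∞) : ℝ≥0∞) = ∑' i : ℕ, ‖fiber (φ i) t‖ₑ) := by
  obtain ⟨J, v, hJ, hv, hv1, hvo, hvs, hvJ, hvJo, hdim⟩ :=
    exists_quasi_orthonormal_frame hVclosed hVshift
  have hnorm : ∀ i t, ‖v i t‖ ≤ 1 := fun i t => by
    by_cases h : v i t = 0
    · simp [h]
    · exact (hv1 i t h).le
  -- A field bounded by `1` is square-integrable because the cube has finite measure.
  choose φ hφ using fun i => exists_fiber_eq_of_bound (hv i).aestronglyMeasurable 1 (hnorm i)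
  have hψ := fun i => isRangeFunctionOf_psi (hv i).aestronglyMeasurable (hv1 i) (hφ i)
  have hφV : ∀ i, φ i ∈ V := fun i => by
    rw [hJ.2]
    filter_upwards [hφ i] with t ht
    rw [ht]
    exact hvJ i t
  have hψV : ∀ i, psi (φ i) ≤ V := fun i => psi_le hVclosed fun k => hVshift _ (hφV i) k
  -- Almost everywhere uniqueness replaces an arbitrary range function of `psi (φ i)` by the line or
  -- zero space spanned by `v i t`.
  have hspec : ∀ (i : ℕ) (K : RangeFunction n s), IsRangeFunctionOf K (psi (φ i)) →
      ∀ᵐ t : Cube n, t ∈ K.spectrum ↔ v i t ≠ 0 := fun i K hK => by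
    filter_upwards [hK.ae_eq (hψ i)] with t ht
    change (K t).toSubmodule ≠ ⊥ ↔ _
    rw [ht, Ne, Ne, not_iff_not]
    exact Submodule.span_singleton_eq_bot
  refine ⟨⟨J, hJ⟩, φ, fun i j hij => psi_isOrtho ?_, le_antisymm ?_ ?_, fun i => ⟨_, hψ i⟩,
    fun i K hK => ?_, fun i K K' hK hK' => ?_, fun J' hJ' => ?_⟩
  · filter_upwards [hφ i, hφ j] with t h1 h2
    rw [h1, h2, hvo i j t hij]
  · intro f hf
    set W := (⨆ i, psi (φ i)).topologicalClosure
    have : CompleteSpace W := (Submodule.isClosed_topologicalClosure _).completeSpace_coe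
    have hWV : W ≤ V := Submodule.topologicalClosure_minimal _ (iSup_le hψV) hVclosed
    -- The remainder belongs to `V`, so its fiber lies in `J t`; it is orthogonal to every `psi (φ
    -- i)`, so its fiber is orthogonal to every `v i t` and hence to `J t`.
    have hz : f - W.starProjection f = 0 := by
      have h1 : f - W.starProjection f ∈ V :=
        V.sub_mem hf (hWV (Submodule.starProjection_apply_mem _ _))
      have h2 : ∀ i, f - W.starProjection f ∈ (psi (φ i))ᗮ := fun i =>
        Submodule.orthogonal_le ((le_iSup (fun i => psi (φ i)) i).trans
          (Submodule.le_topologicalClosure _)) (Submodule.sub_starProjection_mem_orthogonal f)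
      refine eq_zero_of_fiber_ae ?_
      filter_upwards [(hJ.2 _).mp h1, ae_all_iff.mpr fun i => mem_orthogonal_psi_iff.mp (h2 i),
        ae_all_iff.mpr hφ] with t h3 h4 h5
      refine eq_zero_of_mem_of_mem_orthogonal h3 (hvJo t _ fun i => ?_)
      rw [← h5, h4]
    rw [sub_eq_zero.mp hz]
    exact Submodule.starProjection_apply_mem _ _
  · exact Submodule.topologicalClosure_minimal _ (iSup_le hψV) hVclosed
  · filter_upwards [hspec i K hK, hφ i] with t h1 h2
    rw [h2]
    by_cases h : v i t = 0
    · rw [Set.indicator_of_notMem (by rw [h1]; simpa using h), h, norm_zero]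
    · rw [Set.indicator_of_mem (by rw [h1]; exact h), hv1 i t h]
  · filter_upwards [hspec i K hK, hspec (i + 1) K' hK'] with t h1 h2
    rw [h1, h2]
    exact hvs i t
  · filter_upwards [hJ'.ae_eq hJ, ae_all_iff.mpr hφ] with t h1 h2
    simp_rw [h2]
    rw [← hdim t, RangeFunction.dim, RangeFunction.dim, h1]
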